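/- Let $\mathcal M$ be a smooth oriented Riemannian $3$-manifold with metric $\langle\cdot,\cdot\rangle$ and Levi-Civita connection $\overline\nabla$, let $\mathbb M^2$ be a smooth Riemannian surface with Gauss curvature $\kappa$, and let $\pi:\mathcal M\to\mathbb M^2$ be a Killing submersion: a (surjective) Riemannian submersion whose fibers are the trajectories of a unit Killing vector field $\xi$ on $\mathcal M$. For $u,v\in T_p\mathcal M$ let $u\wedge v\in T_p\mathcal M$ denote the cross product, defined by $\langle u\wedge v,w\rangle=\det(u,v,w)$ for all $w\in T_p\mathcal M$, where $\det$ is the oriented Riemannian volume form. A tangent vector is horizontal if it is orthogonal to the fiber of $\pi$ through its base point. Let $\bar K(u,v)$ denote the sectional curvature of the plane spanned by linearly independent $u,v\in T_p\mathcal M$. Then: (1) There exists a function $\tau:\mathcal M\to\mathbb R$ such that $$\overline\nabla_u\,\xi=\tau(p)\,u\wedge\xi_p\qquad\text{for all } p\in\mathcal M,\ u\in T_p\mathcal M .$$ (2) For every function $\tau$ as in (1) and every $p\in\mathcal M$: - if $u,v\in T_p\mathcal M$ are horizontal and linearly independent (in particular, if they are orthonormal and $\{u,v,\xi_p\}$ is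 positively oriented), then $\bar K(u,v)=\kappa(\pi(p))-3\,\tau(p)^2$; - if $u\in T_p\mathcal M$ and $\xi_p$ are linearly independent (in particular, if $u$ is a horizontal unit vector), then $\bar K(u,\xi_p)=\tau(p)^2$. -/

import Mathlib

open Bundle FiberBundle VectorField
open scoped Manifold ContDiff Topology

noncomputable section

namespace KillingSubmersion

section Connection

variable {E : Type*} [NormedAddCommGroup E] [NormedSpace ℝ E] [FiniteDimensional ℝ E]
  {H : Type*} [TopologicalSpace H] (I : ModelWithCorners ℝ E H)
  {M : Type*} [TopologicalSpace M] [ChartedSpace H M] [IsManifold I ∞ M]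
  [RiemannianBundle (fun x : M ↦ TangentSpace I x)]
  [IsContMDiffRiemannianBundle I ∞ E (fun x : M ↦ TangentSpace I x)]

/-- The right-hand side of Koszul's formula for `⟨∇_X Y, Z⟩` at the point `x`. -/
def koszul (X Y Z : Π x : M, TangentSpace I x) (x : M) : ℝ :=
  (1 / 2 : ℝ) *
    (mvfderiv I (fun y : M ↦ inner ℝ (Y y) (Z y)) x (X x)
      + mvfderiv I (fun y : M ↦ inner ℝ (X y) (Z y)) x (Y x)
      - mvfderiv I (fun y : M ↦ inner ℝ (X y) (Y y)) x (Z x)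
      + inner ℝ (mlieBracket I X Y x) (Z x)
      - inner ℝ (mlieBracket I X Z x) (Y x)
      - inner ℝ (mlieBracket I Y Z x) (X x))

variable {I}

set_option linter.unusedSectionVars false in
theorem mdifferentiableAt_inner {X Y : Π x : M, TangentSpace I x} {x : M}
    (hX : MDiffAt (T% X) x) (hY : MDiffAt (T% Y) x) :
    MDiffAt (fun y : M ↦ inner ℝ (X y) (Y y)) x :=
  MDifferentiableAt.inner_bundle (IB := I) (F := E) (E := fun x : M ↦ TangentSpace I x)
    (b := fun y ↦ y) hX hY

theorem koszul_tensorial_left {Y Z : Π x : M, TangentSpace I x} {x : M}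
    (hY : MDiffAt (T% Y) x) (hZ : MDiffAt (T% Z) x) :
    TensorialAt I E (fun X ↦ koszul I X Y Z x) x where
  smul {f X} hf hX := by
    simp only [koszul, Pi.smul_apply', inner_smul_left, inner_smul_right]
    simp [mvfderiv_fun_mul hf (mdifferentiableAt_inner hX hZ), mvfderiv_fun_mul hf (mdifferentiableAt_inner hX hY),
      mlieBracket_smul_left hf hX, inner_add_left, inner_smul_left]
    ring
  add {X X'} hX hX' := by
    simp only [koszul, Pi.add_apply, inner_add_left, inner_add_right]
    simp [mvfderiv_fun_add (mdifferentiableAt_inner hX hZ) (mdifferentiableAt_inner hX' hZ),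
      mvfderiv_fun_add (mdifferentiableAt_inner hX hY) (mdifferentiableAt_inner hX' hY),
      mlieBracket_add_left hX hX', inner_add_left]
    ring

theorem koszul_tensorial_right {X Y : Π x : M, TangentSpace I x} {x : M}
    (hX : MDiffAt (T% X) x) (hY : MDiffAt (T% Y) x) :
    TensorialAt I E (fun Z ↦ koszul I X Y Z x) x where
  smul {f Z} hf hZ := by
    simp only [koszul, Pi.smul_apply', inner_smul_right]
    simp [mvfderiv_fun_mul hf (mdifferentiableAt_inner hX hZ),
      mvfderiv_fun_mul hf (mdifferentiableAt_inner hY hZ), mlieBracket_smul_right hf hZ, inner_add_left, inner_smul_left, real_inner_comm]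
    ring
  add {Z Z'} hZ hZ' := by
    simp only [koszul, Pi.add_apply, inner_add_right]
    simp [mvfderiv_fun_add (mdifferentiableAt_inner hX hZ) (mdifferentiableAt_inner hX hZ'),
      mvfderiv_fun_add (mdifferentiableAt_inner hY hZ) (mdifferentiableAt_inner hY hZ'),
      mlieBracket_add_right hZ hZ', inner_add_left]
    ring

theorem koszul_add_mid {X Y Y' Z : Π x : M, TangentSpace I x} {x : M}
    (hX : MDiffAt (T% X) x) (hY : MDiffAt (T% Y) x) (hY' : MDiffAt (T% Y') x)
    (hZ : MDiffAt (T% Z) x) :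
    koszul I X (Y + Y') Z x = koszul I X Y Z x + koszul I X Y' Z x := by
  simp only [koszul, Pi.add_apply, inner_add_left, inner_add_right]
  simp [mvfderiv_fun_add (mdifferentiableAt_inner hX hY) (mdifferentiableAt_inner hX hY'),
    mvfderiv_fun_add (mdifferentiableAt_inner hY hZ) (mdifferentiableAt_inner hY' hZ),
    mlieBracket_add_right hY hY', mlieBracket_add_left hY hY', inner_add_left]
  ring

theorem koszul_smul_mid {X Y Z : Π x : M, TangentSpace I x} {f : M → ℝ} {x : M}
    (hX : MDiffAt (T% X) x) (hY : MDiffAt (T% Y) x) (hZ : MDiffAt (T% Z) x)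
    (hf : MDiffAt f x) :
    koszul I X (f • Y) Z x =
      f x * koszul I X Y Z x + mvfderiv I f x (X x) * inner ℝ (Y x) (Z x) := by
  simp only [koszul, Pi.smul_apply', inner_smul_left, inner_smul_right]
  simp [mvfderiv_fun_mul hf (mdifferentiableAt_inner hX hY), mvfderiv_fun_mul hf (mdifferentiableAt_inner hY hZ),
    mlieBracket_smul_right hf hY, mlieBracket_smul_left hf hY, inner_add_left, inner_smul_left,
    real_inner_comm]
  ring

instance (x : M) : FiniteDimensional ℝ (TangentSpace I x) :=
  inferInstanceAs (FiniteDimensional ℝ E)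

instance (x : M) : CompleteSpace (TangentSpace I x) := FiniteDimensional.complete ℝ _

open Classical in
/-- `∇ Y` at `x`, as the endomorphism `u ↦ ∇_u Y` of the tangent space, given by Koszul's formula
`⟨∇_u Y, w⟩ = koszul X Y Z x` for any differentiable `X`, `Z` with `X x = u`, `Z x = w`
(and `0` if `Y` is not differentiable at `x`). -/
def leviCivitaFun (Y : Π x : M, TangentSpace I x) (x : M) :
    TangentSpace I x →L[ℝ] TangentSpace I x :=
  if hY : MDiffAt (T% Y) x then
    LinearMap.toContinuousLinearMap
      { toFun := fun u ↦ (InnerProductSpace.toDual ℝ (TangentSpace I x)).symm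
          (TensorialAt.mkHom₂ (fun X Z ↦ koszul I X Y Z x) x
            (fun _ hZ ↦ koszul_tensorial_left hY hZ)
            (fun _ hX ↦ koszul_tensorial_right hX hY) u)
        map_add' := fun u v ↦ by simp
        map_smul' := fun c u ↦ by simp }
  else 0

theorem inner_leviCivitaFun {X Y Z : Π x : M, TangentSpace I x} {x : M}
    (hX : MDiffAt (T% X) x) (hY : MDiffAt (T% Y) x) (hZ : MDiffAt (T% Z) x) :
    inner ℝ (leviCivitaFun Y x (X x)) (Z x) = koszul I X Y Z x := by
  simp only [leviCivitaFun, hY, dite_true]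
  simp [TensorialAt.mkHom₂_apply _ _ hX hZ]

theorem leviCivitaFun_isCovariantDerivativeOn :
    IsCovariantDerivativeOn E
      (leviCivitaFun : (Π x : M, TangentSpace I x) →
        Π x : M, TangentSpace I x →L[ℝ] TangentSpace I x) Set.univ where
  add {Y Y' x} hY hY' _ := by
    ext u
    refine ext_inner_right ℝ fun w ↦ ?_
    have hu := mdifferentiableAt_extend I E (V := (TangentSpace I : M → Type _)) u
    have hw := mdifferentiableAt_extend I E (V := (TangentSpace I : M → Type _)) w
    have h := inner_leviCivitaFun hu (mdifferentiableAt_add_section hY hY') hw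
    have h₁ := inner_leviCivitaFun hu hY hw
    have h₂ := inner_leviCivitaFun hu hY' hw
    rw [koszul_add_mid hu hY hY' hw, ← h₁, ← h₂] at h
    simpa [inner_add_left] using h
  leibniz {Y f x} hY hf _ := by
    ext u
    refine ext_inner_right ℝ fun w ↦ ?_
    have hu := mdifferentiableAt_extend I E (V := (TangentSpace I : M → Type _)) u
    have hw := mdifferentiableAt_extend I E (V := (TangentSpace I : M → Type _)) w
    have h := inner_leviCivitaFun hu (hf.smul_section hY) hw
    have h₁ := inner_leviCivitaFun hu hY hw
    rw [koszul_smul_mid hu hY hw hf, ← h₁] at h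
    simpa [inner_add_left, inner_smul_left] using h

variable (I) in
/-- The Levi-Civita connection; `leviCivita I Y x u` is `∇_u Y`. -/
def leviCivita : CovariantDerivative I E (TangentSpace I : M → Type _) where
  toFun := leviCivitaFun
  isCovariantDerivativeOnUniv := leviCivitaFun_isCovariantDerivativeOn

theorem leviCivita_torsion : (leviCivita I (M := M)).torsion = 0 := by
  rw [CovariantDerivative.torsion_eq_zero_iff]
  intro X Y x hX hY
  refine ext_inner_right ℝ fun w ↦ ?_
  have hw := mdifferentiableAt_extend I E (V := (TangentSpace I : M → Type _)) w
  have h₁ := inner_leviCivitaFun hX hY hw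
  have h₂ := inner_leviCivitaFun hY hX hw
  rw [extend_apply_self] at h₁ h₂
  rw [inner_sub_left]
  change inner ℝ (leviCivitaFun Y x (X x)) w - inner ℝ (leviCivitaFun X x (Y x)) w = _
  rw [h₁, h₂, koszul, koszul, mlieBracket_swap_apply (V := Y) (W := X)]
  simp only [real_inner_comm, inner_neg_left, extend_apply_self]
  ring

theorem leviCivita_metric {X Y Z : Π x : M, TangentSpace I x} {x : M}
    (hX : MDiffAt (T% X) x) (hY : MDiffAt (T% Y) x) (hZ : MDiffAt (T% Z) x) :
    mvfderiv I (fun y : M ↦ inner ℝ (Y y) (Z y)) x (X x) =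
      inner ℝ (leviCivita I Y x (X x)) (Z x) + inner ℝ (Y x) (leviCivita I Z x (X x)) := by
  have h₁ := inner_leviCivitaFun hX hY hZ
  have h₂ := inner_leviCivitaFun hX hZ hY
  change _ = inner ℝ (leviCivitaFun Y x (X x)) (Z x) + inner ℝ (Y x) (leviCivitaFun Z x (X x))
  rw [real_inner_comm (leviCivitaFun Z x (X x)) (Y x), h₁, h₂, koszul, koszul,
    mlieBracket_swap_apply (V := Z) (W := Y)]
  simp only [real_inner_comm, inner_neg_left]
  ring

variable (I) in
/-- `R(X, Y)Z = ∇_X ∇_Y Z - ∇_Y ∇_X Z - ∇_[X,Y] Z` for vector fields. -/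
def curvatureField (X Y Z : Π x : M, TangentSpace I x) (x : M) : TangentSpace I x :=
  leviCivita I (fun y ↦ leviCivita I Z y (Y y)) x (X x)
    - leviCivita I (fun y ↦ leviCivita I Z y (X y)) x (Y x)
    - leviCivita I Z x (mlieBracket I X Y x)

variable (I) in
/-- The Riemann curvature tensor `R(u, v)w` at `x`, evaluated through extensions of the tangent
vectors to vector fields that are smooth near `x`; by tensoriality the choice is immaterial. -/
def curvature (x : M) (u v w : TangentSpace I x) : TangentSpace I x :=
  curvatureField I (extend E u) (extend E v) (extend E w) x

variable (I) in
/-- The sectional curvature of the plane of `T_x M` spanned by the linearly independent vectors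
`u` and `v`. -/
def sectionalCurvature (x : M) (u v : TangentSpace I x) : ℝ :=
  inner ℝ (curvature I x u v v) u / (‖u‖ ^ 2 * ‖v‖ ^ 2 - inner ℝ u v ^ 2)

variable (I) in
/-- `ξ` is a Killing field: it is smooth and the Lie derivative of the metric along `ξ` vanishes,
that is, `ξ⟨X, Y⟩ = ⟨[ξ, X], Y⟩ + ⟨X, [ξ, Y]⟩`. -/
structure IsKilling (ξ : Π x : M, TangentSpace I x) : Prop where
  smooth : CMDiff ∞ (T% ξ)
  lie_metric : ∀ (x : M) (X Y : Π x : M, TangentSpace I x),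
    MDiffAt (T% X) x → MDiffAt (T% Y) x →
      mvfderiv I (fun y : M ↦ inner ℝ (X y) (Y y)) x (ξ x) =
        inner ℝ (mlieBracket I ξ X x) (Y x) + inner ℝ (X x) (mlieBracket I ξ Y x)

variable (I) in
/-- The trajectory of `ξ` through `p`: all points reached from `p` along integral curves of `ξ`
defined on open intervals containing `0`. -/
def trajectory (ξ : Π x : M, TangentSpace I x) (p : M) : Set M :=
  {q | ∃ (γ : ℝ → M) (s : Set ℝ), IsOpen s ∧ s.OrdConnected ∧ (0 : ℝ) ∈ s ∧
    IsMIntegralCurveOn (I := I) γ ξ s ∧ γ 0 = p ∧ q ∈ γ '' s}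

end Connection

section Surface

variable {B : Type*} [TopologicalSpace B] [ChartedSpace (EuclideanSpace ℝ (Fin 2)) B]
  [IsManifold (𝓡 2) ∞ B] [RiemannianBundle (fun b : B ↦ TangentSpace (𝓡 2) b)]
  [IsContMDiffRiemannianBundle (𝓡 2) ∞ (EuclideanSpace ℝ (Fin 2))
    (fun b : B ↦ TangentSpace (𝓡 2) b)]

/-- The Gauss curvature of a surface: the sectional curvature of the tangent plane, computed in
the basis of coordinate vectors (the choice of the basis is immaterial). -/
def gaussCurvature (b : B) : ℝ :=
  sectionalCurvature (𝓡 2) b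
    (EuclideanSpace.single 0 1 : EuclideanSpace ℝ (Fin 2))
    (EuclideanSpace.single 1 1 : EuclideanSpace ℝ (Fin 2))

end Surface

section Orientation

variable {M : Type*} [TopologicalSpace M] [ChartedSpace (EuclideanSpace ℝ (Fin 3)) M]

instance (x : M) : Fact (Module.finrank ℝ (TangentSpace (𝓡 3) x) = 3) :=
  ⟨(finrank_euclideanSpace_fin : Module.finrank ℝ (EuclideanSpace ℝ (Fin 3)) = 3)⟩

variable [IsManifold (𝓡 3) ∞ M] [RiemannianBundle (fun x : M ↦ TangentSpace (𝓡 3) x)]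

variable (M) in
/-- An orientation of a Riemannian `3`-manifold: an orientation of every tangent space such that
a smooth local frame that is positive at a point stays positive nearby. -/
structure ManifoldOrientation where
  orient : Π x : M, Orientation ℝ (TangentSpace (𝓡 3) x) (Fin 3)
  locally_pos : ∀ (x₀ : M) (X : Fin 3 → Π x : M, TangentSpace (𝓡 3) x),
    (∀ i, ContMDiffAt (𝓡 3) (𝓡 3).tangent ∞
      (fun x ↦ (⟨x, X i x⟩ : TangentBundle (𝓡 3) M)) x₀) →
    0 < (orient x₀).volumeForm (fun i ↦ X i x₀) →
    ∀ᶠ x in 𝓝 x₀, 0 < (orient x).volumeForm (fun i ↦ X i x)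

/-- The cross product `u ∧ v` in the oriented Euclidean space `T_x M`, characterized by
`⟨u ∧ v, w⟩ = det(u, v, w)`. -/
def cross (o : ManifoldOrientation M) {x : M} (u v : TangentSpace (𝓡 3) x) :
    TangentSpace (𝓡 3) x :=
  (InnerProductSpace.toDual ℝ (TangentSpace (𝓡 3) x)).symm
    (LinearMap.toContinuousLinearMap
      { toFun := fun w ↦ (o.orient x).volumeForm ![u, v, w]
        map_add' := fun w w' ↦ by
          have e : ∀ z, Function.update ![u, v, 0] 2 z = ![u, v, z] := fun z ↦ by
            ext i; fin_cases i <;> rfl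
          have := (o.orient x).volumeForm.map_update_add ![u, v, 0] 2 w w'
          rwa [e, e, e] at this
        map_smul' := fun c w ↦ by
          have e : ∀ z, Function.update ![u, v, 0] 2 z = ![u, v, z] := fun z ↦ by
            ext i; fin_cases i <;> rfl
          have := (o.orient x).volumeForm.map_update_smul ![u, v, 0] 2 c w
          rwa [e, e] at this })

theorem inner_cross (o : ManifoldOrientation M) {x : M} (u v w : TangentSpace (𝓡 3) x) :
    inner ℝ (cross o u v) w = (o.orient x).volumeForm ![u, v, w] := by
  simp [cross]

end Orientation

section Submersion

variable {M : Type*} [TopologicalSpace M] [ChartedSpace (EuclideanSpace ℝ (Fin 3)) M]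
  [IsManifold (𝓡 3) ∞ M] [RiemannianBundle (fun x : M ↦ TangentSpace (𝓡 3) x)]
  {B : Type*} [TopologicalSpace B] [ChartedSpace (EuclideanSpace ℝ (Fin 2)) B]
  [IsManifold (𝓡 2) ∞ B] [RiemannianBundle (fun b : B ↦ TangentSpace (𝓡 2) b)]

/-- The tangent vector `u` at `p` is horizontal: orthogonal to the fiber of `pr` through `p`. -/
def IsHorizontal (pr : M → B) (p : M) (u : TangentSpace (𝓡 3) p) : Prop :=
  ∀ w : TangentSpace (𝓡 3) p, mfderiv (𝓡 3) (𝓡 2) pr p w = 0 → inner ℝ u w = 0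

/-- `pr` is a Riemannian submersion: smooth, onto, of maximal rank, and its differential preserves
the lengths of horizontal vectors. -/
structure IsRiemannianSubmersion (pr : M → B) : Prop where
  smooth : ContMDiff (𝓡 3) (𝓡 2) ∞ pr
  surjective : Function.Surjective pr
  mfderiv_surjective : ∀ p : M, Function.Surjective (mfderiv (𝓡 3) (𝓡 2) pr p)
  norm_mfderiv : ∀ (p : M) (u : TangentSpace (𝓡 3) p), IsHorizontal pr p u →
    ‖mfderiv (𝓡 3) (𝓡 2) pr p u‖ = ‖u‖

variable [IsContMDiffRiemannianBundle (𝓡 3) ∞ (EuclideanSpace ℝ (Fin 3))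
    (fun x : M ↦ TangentSpace (𝓡 3) x)]

/-- A Killing submersion: a Riemannian submersion of a `3`-manifold over a surface whose fibers
are the trajectories of the unit Killing field `ξ`. -/
structure IsKillingSubmersion (pr : M → B) (ξ : Π x : M, TangentSpace (𝓡 3) x) : Prop where
  submersion : IsRiemannianSubmersion pr
  killing : IsKilling (𝓡 3) ξ
  unit : ∀ p : M, ‖ξ p‖ = 1
  fiber_eq : ∀ p : M, pr ⁻¹' {pr p} = trajectory (𝓡 3) ξ p

/-- The relation `∇_X ξ = τ X ∧ ξ` for all tangent vectors `X`. -/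
def IsBundleCurvature (o : ManifoldOrientation M) (ξ : Π x : M, TangentSpace (𝓡 3) x)
    (τ : M → ℝ) : Prop :=
  ∀ (p : M) (u : TangentSpace (𝓡 3) p), leviCivita (𝓡 3) ξ p u = τ p • cross o u (ξ p)

end Submersion

end KillingSubmersion

end

noncomputable section

namespace KillingSubmersion

section Calculus

set_option linter.unusedSectionVars false

variable {E : Type*} [NormedAddCommGroup E] [NormedSpace ℝ E] [FiniteDimensional ℝ E]
  {H : Type*} [TopologicalSpace H] {I : ModelWithCorners ℝ E H}
  {M : Type*} [TopologicalSpace M] [ChartedSpace H M] [IsManifold I ∞ M]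

theorem isManifold_coe_add_one (n : ℕ∞) : IsManifold I ((n : ℕ∞ω) + 1) M :=
  IsManifold.of_le (n := ∞) (by exact_mod_cast le_top (a := n + 1))

/-- The Lie bracket of `C^n` vector fields is `C^m` for `m + 1 ≤ n`. -/
theorem contMDiffAt_mlieBracket {m n : ℕ∞} (hmn : m + 1 ≤ n)
    {X Y : Π x : M, TangentSpace I x} {x : M}
    (hX : CMDiffAt n (T% X) x) (hY : CMDiffAt n (T% Y) x) :
    CMDiffAt m (T% (mlieBracket I X Y)) x := by
  have := isManifold_coe_add_one (I := I) (M := M) n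
  have : IsManifold I (minSmoothness ℝ 2) M := by
    rw [minSmoothness_of_isRCLikeNormedField]; infer_instance
  refine hX.mlieBracket_vectorField hY ?_
  rw [minSmoothness_of_isRCLikeNormedField]
  exact_mod_cast hmn

theorem eventually_mdifferentiableAt {X : Π x : M, TangentSpace I x} {x : M} {n : ℕ∞ω}
    (hn : 1 ≤ n) (hX : CMDiffAt n (T% X) x) : ∀ᶠ y in 𝓝 x, MDiffAt (T% X) y :=
  ((contMDiffAt_iff_contMDiffAt_nhds (by simp)).1 (hX.of_le hn)).mono fun _ h ↦ h.mdifferentiableAt one_ne_zero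

theorem eventually_mdifferentiableAt_fun {f : M → ℝ} {x : M} {n : ℕ∞ω}
    (hn : 1 ≤ n) (hf : CMDiffAt n f x) : ∀ᶠ y in 𝓝 x, MDiffAt f y :=
  ((contMDiffAt_iff_contMDiffAt_nhds (by simp)).1 (hf.of_le hn)).mono fun _ h ↦ h.mdifferentiableAt one_ne_zero

theorem mvfderiv_congr {f g : M → ℝ} {x : M} (h : f =ᶠ[𝓝 x] g) :
    mvfderiv I f x = mvfderiv I g x := by
  ext u
  exact DFunLike.congr_fun (h.mfderiv_eq (I := I) (I' := 𝓘(ℝ, ℝ))) u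

variable [RiemannianBundle (fun x : M ↦ TangentSpace I x)]
  [IsContMDiffRiemannianBundle I ∞ E (fun x : M ↦ TangentSpace I x)]

theorem contMDiffAt_inner {n : ℕ∞} {X Y : Π x : M, TangentSpace I x} {x : M}
    (hX : CMDiffAt n (T% X) x) (hY : CMDiffAt n (T% Y) x) :
    CMDiffAt n (fun y : M ↦ inner ℝ (X y) (Y y)) x := by
  have : IsContMDiffRiemannianBundle I n E (fun x : M ↦ TangentSpace I x) :=
    IsContMDiffRiemannianBundle.of_le (n := ∞) (by exact_mod_cast le_top)
  exact ContMDiffAt.inner_bundle (IB := I) (F := E) (E := fun x : M ↦ TangentSpace I x)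
    (b := fun y ↦ y) hX hY

/-- The derivative of a `C^n` function along a `C^n` vector field is `C^m` for `m + 1 ≤ n`. -/
theorem contMDiffAt_mvfderiv_apply [Nontrivial E] {m n : ℕ∞} (hmn : m + 1 ≤ n)
    {f : M → ℝ} {X : Π x : M, TangentSpace I x} {x : M}
    (hf : CMDiffAt n f x) (hX : CMDiffAt n (T% X) x) :
    CMDiffAt m (fun y ↦ mvfderiv I f y (X y)) x := by
  obtain ⟨w, hw⟩ : ∃ w : TangentSpace I x, w ≠ 0 := exists_ne (α := E) 0
  set W : Π x : M, TangentSpace I x := extend E w with hWdef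
  have hW : CMDiffAt n (T% W) x := contMDiffAt_extend I E w
  have h1n : (1 : ℕ∞ω) ≤ n := by exact_mod_cast le_trans le_add_self hmn
  have hmn' : (m : ℕ∞ω) ≤ n := by exact_mod_cast le_trans le_self_add hmn
  have hWW := contMDiffAt_inner (hW.of_le hmn') (hW.of_le hmn')
  have hne : inner ℝ (W x) (W x) ≠ 0 := by simpa [hWdef] using hw
  have hbr : CMDiffAt m (fun y ↦ (inner ℝ (mlieBracket I X (f • W) y) (W y)
      - f y * inner ℝ (mlieBracket I X W y) (W y)) / inner ℝ (W y) (W y)) x := by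
    refine ContMDiffAt.div₀ ?_ hWW hne
    refine ContMDiffAt.sub ?_ (ContMDiffAt.mul (hf.of_le hmn') ?_)
    · exact contMDiffAt_inner (contMDiffAt_mlieBracket hmn hX (hf.smul_section hW)) (hW.of_le hmn')
    · exact contMDiffAt_inner (contMDiffAt_mlieBracket hmn hX hW) (hW.of_le hmn')
  refine hbr.congr_of_eventuallyEq ?_
  filter_upwards [eventually_mdifferentiableAt h1n hW, eventually_mdifferentiableAt_fun h1n hf,
    hWW.continuousAt.eventually_ne hne] with y hWy hfy hy
  rw [mlieBracket_smul_right hfy hWy, inner_add_left, real_inner_smul_left, real_inner_smul_left]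
  field_simp
  ring

/-- The Lie bracket acts on functions as the commutator of derivations. -/
theorem mvfderiv_mlieBracket [Nontrivial E] {f : M → ℝ} {X Y : Π x : M, TangentSpace I x} {x : M}
    (hf : CMDiffAt 2 f x) (hX : CMDiffAt 2 (T% X) x) (hY : CMDiffAt 2 (T% Y) x) :
    mvfderiv I f x (mlieBracket I X Y x) =
      mvfderiv I (fun y ↦ mvfderiv I f y (Y y)) x (X x)
        - mvfderiv I (fun y ↦ mvfderiv I f y (X y)) x (Y x) := by
  obtain ⟨w, hw⟩ : ∃ w : TangentSpace I x, w ≠ 0 := exists_ne (α := E) 0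
  set W : Π x : M, TangentSpace I x := extend E w with hWdef
  have hW : CMDiffAt 2 (T% W) x := contMDiffAt_extend I E w
  have hWx : W x ≠ 0 := by simpa [hWdef] using hw
  have : IsManifold I (minSmoothness ℝ 3) M := by
    rw [minSmoothness_of_isRCLikeNormedField]; infer_instance
  have e12 : ((1 : ℕ∞) + 1) ≤ 2 := by norm_num
  have h12 : (1 : ℕ∞ω) ≤ 2 := by norm_num
  have key : ∀ {W : Π x : M, TangentSpace I x}, CMDiffAt 2 (T% W) x →
      mlieBracket I X (mlieBracket I Y W) x =
      mlieBracket I (mlieBracket I X Y) W x + mlieBracket I Y (mlieBracket I X W) x := by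
    intro W hW
    apply leibniz_identity_mlieBracket_apply <;>
      rwa [minSmoothness_of_isRCLikeNormedField]
  have dmd : ∀ {Z : Π x : M, TangentSpace I x}, CMDiffAt 2 (T% Z) x → MDiffAt (T% Z) x :=
    fun h ↦ h.mdifferentiableAt two_ne_zero
  have brd : ∀ {Z Z' : Π x : M, TangentSpace I x}, CMDiffAt 2 (T% Z) x → CMDiffAt 2 (T% Z') x →
      MDiffAt (T% (mlieBracket I Z Z')) x := fun h h' ↦
    (contMDiffAt_mlieBracket e12 h h').mdifferentiableAt (by simp)
  have dfd : ∀ {Z : Π x : M, TangentSpace I x}, CMDiffAt 2 (T% Z) x →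
      MDiffAt (fun y ↦ mvfderiv I f y (Z y)) x := fun h ↦
    (contMDiffAt_mvfderiv_apply e12 hf h).mdifferentiableAt (by simp)
  have hfd : MDiffAt f x := hf.mdifferentiableAt two_ne_zero
  have expand : ∀ {Z Z' : Π x : M, TangentSpace I x}, CMDiffAt 2 (T% Z) x →
      CMDiffAt 2 (T% Z') x → mlieBracket I Z (mlieBracket I Z' (f • W)) x =
      (mvfderiv I (fun y ↦ mvfderiv I f y (Z' y)) x (Z x) • W x
        + mvfderiv I f x (Z' x) • mlieBracket I Z W x)
      + (mvfderiv I f x (Z x) • mlieBracket I Z' W x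
        + f x • mlieBracket I Z (mlieBracket I Z' W) x) := by
    intro Z Z' hZ hZ'
    have e : mlieBracket I Z' (f • W) =ᶠ[𝓝 x]
        (fun y ↦ mvfderiv I f y (Z' y)) • W + f • mlieBracket I Z' W := by
      filter_upwards [eventually_mdifferentiableAt h12 hW,
        eventually_mdifferentiableAt_fun h12 hf] with y hWy hfy
      rw [mlieBracket_smul_right hfy hWy]
      rfl
    rw [Filter.EventuallyEq.mlieBracket_vectorField_eq (Filter.EventuallyEq.refl _ Z) e,
      mlieBracket_add_right ((dfd hZ').smul_section (dmd hW)) (hfd.smul_section (brd hZ' hW)),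
      mlieBracket_smul_right (dfd hZ') (dmd hW), mlieBracket_smul_right hfd (brd hZ' hW)]
  have J := key (hf.smul_section hW)
  have J' := key hW
  rw [expand hX hY, expand hY hX, mlieBracket_smul_right hfd (dmd hW), J'] at J
  have : (mvfderiv I f x (mlieBracket I X Y x) -
      (mvfderiv I (fun y ↦ mvfderiv I f y (Y y)) x (X x)
        - mvfderiv I (fun y ↦ mvfderiv I f y (X y)) x (Y x))) • W x = 0 := by
    rw [← sub_eq_zero] at J
    rw [← neg_eq_zero, ← J]
    module
  exact sub_eq_zero.1 ((smul_eq_zero.1 this).resolve_right hWx)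

end Calculus

section Smoothness

set_option linter.unusedSectionVars false

variable {E : Type*} [NormedAddCommGroup E] [NormedSpace ℝ E] [FiniteDimensional ℝ E]
  {H : Type*} [TopologicalSpace H] {I : ModelWithCorners ℝ E H}
  {M : Type*} [TopologicalSpace M] [ChartedSpace H M] [IsManifold I ∞ M]

theorem contMDiffAt_matrix_det {ι : Type*} [Fintype ι] [DecidableEq ι] {n : ℕ∞ω}
    {A : M → Matrix ι ι ℝ} {x : M} (hA : ∀ i j, CMDiffAt n (fun y ↦ A y i j) x) :
    CMDiffAt n (fun y ↦ (A y).det) x := by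
  simp only [Matrix.det_apply, Units.smul_def, zsmul_eq_mul]
  refine contMDiffAt_finsetSum fun σ _ ↦ ?_
  exact contMDiffAt_const.mul (contMDiffAt_finsetProd fun i _ ↦ hA _ _)

variable [RiemannianBundle (fun x : M ↦ TangentSpace I x)]
  [IsContMDiffRiemannianBundle I ∞ E (fun x : M ↦ TangentSpace I x)]

/-- A vector field is `C^n` if its inner products with smooth vector fields are. -/
theorem contMDiffAt_of_inner {n : ℕ∞} {V : Π x : M, TangentSpace I x} {x : M}
    (h : ∀ Z : Π x : M, TangentSpace I x, CMDiffAt ∞ (T% Z) x →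
      CMDiffAt n (fun y ↦ inner ℝ (V y) (Z y)) x) :
    CMDiffAt n (T% V) x := by
  set e := trivializationAt E (TangentSpace I : M → Type _) x
  have hxe : x ∈ e.baseSet := mem_baseSet_trivializationAt E _ x
  let b := Module.finBasis ℝ E
  let s := e.localFrame b
  have hs : ∀ i, CMDiffAt ∞ (T% (s i)) x := fun i ↦ contMDiffAt_localFrame_of_mem ∞ e b i hxe
  have hle : (n : ℕ∞ω) ≤ ∞ := by exact_mod_cast le_top
  have : ContMDiffVectorBundle n E (TangentSpace I : M → Type _) I :=
    ContMDiffVectorBundle.of_le hle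
  have hG : ∀ i j, CMDiffAt n (fun y ↦ Matrix.gram ℝ (fun i ↦ s i y) i j) x := fun i j ↦
    contMDiffAt_inner ((hs i).of_le hle) ((hs j).of_le hle)
  have hli : ∀ y ∈ e.baseSet, LinearIndependent ℝ (fun i ↦ s i y) := fun y hy ↦
    (e.isLocalFrameOn_localFrame_baseSet I ∞ b).linearIndependent hy
  rw [contMDiffAt_iff_localFrameCoeff b hxe]
  intro i
  have hq : CMDiffAt n (fun y ↦ ((Matrix.gram ℝ (fun i ↦ s i y)).updateCol i
      (fun j ↦ inner ℝ (V y) (s j y))).det / (Matrix.gram ℝ (fun i ↦ s i y)).det) x := by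
    refine ContMDiffAt.div₀ (contMDiffAt_matrix_det fun j k ↦ ?_) (contMDiffAt_matrix_det hG)
      (Matrix.det_gram_ne_zero_iff_linearIndependent.2 (hli x hxe))
    by_cases hk : k = i
    · subst hk
      simpa using h (s j) (hs j)
    · simpa [Matrix.updateCol_apply, hk] using hG j k
  refine hq.congr_of_eventuallyEq ?_
  filter_upwards [e.open_baseSet.mem_nhds hxe] with y hy
  have hdet := Matrix.det_gram_ne_zero_iff_linearIndependent.2 (hli y hy)
  set G := Matrix.gram ℝ (fun i ↦ s i y)
  set c := fun j ↦ e.localFrameCoeff I b j y (V y)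
  have hGc : G.mulVec c = fun j ↦ inner ℝ (V y) (s j y) := by
    ext j
    conv_rhs => rw [e.eq_sum_localFrameCoeff_smul (I := I) (b := b) (s := V) hy]
    rw [sum_inner]
    change ∑ k, G j k * c k = _
    refine Finset.sum_congr rfl fun k _ ↦ ?_
    rw [real_inner_smul_left, real_inner_comm]
    exact mul_comm _ _
  rw [← hGc, ← Matrix.cramer_apply, Matrix.cramer_eq_adjugate_mulVec, Matrix.mulVec_mulVec,
    Matrix.adjugate_mul, Matrix.smul_mulVec, Matrix.one_mulVec, Pi.smul_apply, smul_eq_mul,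
    mul_div_cancel_left₀ _ hdet]
  rfl

theorem inner_leviCivita {X Y Z : Π x : M, TangentSpace I x} {x : M}
    (hX : MDiffAt (T% X) x) (hY : MDiffAt (T% Y) x) (hZ : MDiffAt (T% Z) x) :
    inner ℝ (leviCivita I Y x (X x)) (Z x) = koszul I X Y Z x :=
  inner_leviCivitaFun hX hY hZ

theorem leviCivita_sub_swap {X Y : Π x : M, TangentSpace I x} {x : M}
    (hX : MDiffAt (T% X) x) (hY : MDiffAt (T% Y) x) :
    leviCivita I Y x (X x) - leviCivita I X x (Y x) = mlieBracket I X Y x :=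
  (CovariantDerivative.torsion_eq_zero_iff _).1 leviCivita_torsion hX hY

theorem leviCivita_metric_apply {Y Z : Π x : M, TangentSpace I x} {x : M}
    (hY : MDiffAt (T% Y) x) (hZ : MDiffAt (T% Z) x) (u : TangentSpace I x) :
    mvfderiv I (fun y : M ↦ inner ℝ (Y y) (Z y)) x u =
      inner ℝ (leviCivita I Y x u) (Z x) + inner ℝ (Y x) (leviCivita I Z x u) := by
  have h := leviCivita_metric (mdifferentiableAt_extend I E u) hY hZ
  rwa [extend_apply_self] at h

variable [Nontrivial E]

theorem contMDiffAt_koszul {X Y Z : Π x : M, TangentSpace I x} {x : M}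
    (hX : CMDiffAt ∞ (T% X) x) (hY : CMDiffAt ∞ (T% Y) x) (hZ : CMDiffAt ∞ (T% Z) x) :
    CMDiffAt ∞ (koszul I X Y Z) x := by
  have d : ∀ {X Y Z : Π x : M, TangentSpace I x}, CMDiffAt ∞ (T% X) x → CMDiffAt ∞ (T% Y) x →
      CMDiffAt ∞ (T% Z) x →
      CMDiffAt ∞ (fun y ↦ mvfderiv I (fun y : M ↦ inner ℝ (Y y) (Z y)) y (X y)) x :=
    fun hX hY hZ ↦ contMDiffAt_mvfderiv_apply (m := ⊤) (n := ⊤) le_top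
      (contMDiffAt_inner (n := ⊤) hY hZ) hX
  have l : ∀ {X Y Z : Π x : M, TangentSpace I x}, CMDiffAt ∞ (T% X) x → CMDiffAt ∞ (T% Y) x →
      CMDiffAt ∞ (T% Z) x →
      CMDiffAt ∞ (fun y ↦ inner ℝ (mlieBracket I X Y y) (Z y)) x :=
    fun hX hY hZ ↦ contMDiffAt_inner (n := ⊤)
      (contMDiffAt_mlieBracket (m := ⊤) (n := ⊤) le_top hX hY) hZ
  exact contMDiffAt_const.mul <| ((((d hX hY hZ).add (d hY hX hZ)).sub (d hZ hX hY)).add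
    (l hX hY hZ)).sub (l hX hZ hY) |>.sub (l hY hZ hX)

/-- The covariant derivative of smooth vector fields is smooth. -/
theorem contMDiffAt_leviCivita {X Y : Π x : M, TangentSpace I x} {x : M}
    (hX : CMDiffAt ∞ (T% X) x) (hY : CMDiffAt ∞ (T% Y) x) :
    CMDiffAt ∞ (T% (fun y ↦ leviCivita I Y y (X y))) x := by
  refine contMDiffAt_of_inner (n := ⊤) fun Z hZ ↦ ?_
  refine (contMDiffAt_koszul hX hY hZ).congr_of_eventuallyEq ?_
  have h1 : (1 : ℕ∞ω) ≤ ∞ := by exact_mod_cast le_top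
  filter_upwards [eventually_mdifferentiableAt h1 hX, eventually_mdifferentiableAt h1 hY,
    eventually_mdifferentiableAt h1 hZ] with y hXy hYy hZy
  exact inner_leviCivita hXy hYy hZy

theorem mdifferentiableAt_leviCivita {X Y : Π x : M, TangentSpace I x} {x : M}
    (hX : MDiffAt (T% X) x) (hY : CMDiffAt ∞ (T% Y) x) :
    MDiffAt (T% (fun y ↦ leviCivita I Y y (X y))) x := by
  set e := trivializationAt E (TangentSpace I : M → Type _) x
  have hxe : x ∈ e.baseSet := mem_baseSet_trivializationAt E _ x
  let b := Module.finBasis ℝ E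
  have hs : ∀ i, CMDiffAt ∞ (T% (e.localFrame b i)) x := fun i ↦
    contMDiffAt_localFrame_of_mem ∞ e b i hxe
  have hsum : MDiffAt (T% (fun y ↦ ∑ i, e.localFrameCoeff I b i y (X y) •
      leviCivita I Y y (e.localFrame b i y))) x :=
    .sum_section fun i _ ↦ (mdifferentiableAt_localFrameCoeff b hxe hX i).smul_section
      ((contMDiffAt_leviCivita (hs i) hY).mdifferentiableAt (by simp))
  refine hsum.congr_of_eventuallyEq ?_
  filter_upwards [e.open_baseSet.mem_nhds hxe] with y hy
  congr 1
  conv_lhs => rw [e.eq_sum_localFrameCoeff_smul (I := I) (b := b) (s := X) hy]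
  simp only [map_sum, map_smul]

end Smoothness

section Curvature

set_option linter.unusedSectionVars false

variable {E : Type*} [NormedAddCommGroup E] [NormedSpace ℝ E] [FiniteDimensional ℝ E]
  {H : Type*} [TopologicalSpace H] {I : ModelWithCorners ℝ E H}
  {M : Type*} [TopologicalSpace M] [ChartedSpace H M] [IsManifold I ∞ M]
  [RiemannianBundle (fun x : M ↦ TangentSpace I x)]
  [IsContMDiffRiemannianBundle I ∞ E (fun x : M ↦ TangentSpace I x)]

theorem curvatureField_swap (X Y Z : Π x : M, TangentSpace I x) (x : M) :
    curvatureField I X Y Z x = -curvatureField I Y X Z x := by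
  rw [curvatureField, curvatureField, mlieBracket_swap_apply, map_neg]
  abel

theorem leviCivita_add {Y Z : Π x : M, TangentSpace I x} {x : M}
    (hY : MDiffAt (T% Y) x) (hZ : MDiffAt (T% Z) x) :
    leviCivita I (Y + Z) x = leviCivita I Y x + leviCivita I Z x :=
  (leviCivita I).isCovariantDerivativeOnUniv.add hY hZ

theorem leviCivita_smul_apply {Y : Π x : M, TangentSpace I x} {f : M → ℝ} {x : M}
    (hY : MDiffAt (T% Y) x) (hf : MDiffAt f x) (u : TangentSpace I x) :
    leviCivita I (f • Y) x u = f x • leviCivita I Y x u + mvfderiv I f x u • Y x := by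
  have := (leviCivita I).isCovariantDerivativeOnUniv.leibniz hY hf
  simpa using congr($this u)

theorem leviCivita_congr {Y Z : Π x : M, TangentSpace I x} {x : M}
    (hY : MDiffAt (T% Y) x) (hZ : MDiffAt (T% Z) x) (h : ∀ᶠ y in 𝓝 x, Y y = Z y) :
    leviCivita I Y x = leviCivita I Z x :=
  (leviCivita I).isCovariantDerivativeOnUniv.congr_of_eventuallyEq hY hZ Filter.univ_mem h

variable [Nontrivial E]

theorem curvatureField_tensorial_left {Y Z : Π x : M, TangentSpace I x} {x : M}
    (hZ : CMDiffAt ∞ (T% Z) x) :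
    TensorialAt I E (fun X ↦ curvatureField I X Y Z x) x where
  smul {f X} hf hX := by
    have e : (fun y ↦ leviCivita I Z y ((f • X) y)) = f • fun y ↦ leviCivita I Z y (X y) := by
      ext1 y
      simp
    simp only [curvatureField]
    rw [e, leviCivita_smul_apply (mdifferentiableAt_leviCivita hX hZ) hf,
      mlieBracket_smul_left hf hX]
    simp only [Pi.smul_apply', map_smul, map_add]
    module
  add {X X'} hX hX' := by
    have e : (fun y ↦ leviCivita I Z y ((X + X') y)) =
        (fun y ↦ leviCivita I Z y (X y)) + fun y ↦ leviCivita I Z y (X' y) := by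
      ext1 y
      simp
    simp only [curvatureField]
    rw [e, leviCivita_add (mdifferentiableAt_leviCivita hX hZ)
      (mdifferentiableAt_leviCivita hX' hZ), mlieBracket_add_left hX hX']
    simp only [Pi.add_apply, map_add, add_apply]
    module

theorem inner_curvatureField_skew {X Y Z W : Π x : M, TangentSpace I x} {x : M}
    (hX : CMDiffAt ∞ (T% X) x) (hY : CMDiffAt ∞ (T% Y) x) (hZ : CMDiffAt ∞ (T% Z) x)
    (hW : CMDiffAt ∞ (T% W) x) :
    inner ℝ (curvatureField I X Y Z x) (W x) = -inner ℝ (curvatureField I X Y W x) (Z x) := by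
  have h1 : (1 : ℕ∞ω) ≤ ∞ := by exact_mod_cast le_top
  have h2 : (2 : ℕ∞ω) ≤ ∞ := ENat.LEInfty.out
  have md : ∀ {X : Π x : M, TangentSpace I x}, CMDiffAt ∞ (T% X) x → MDiffAt (T% X) x :=
    fun h ↦ h.mdifferentiableAt (by simp)
  have second : ∀ {X Y : Π x : M, TangentSpace I x}, CMDiffAt ∞ (T% X) x → CMDiffAt ∞ (T% Y) x →
      mvfderiv I (fun y ↦ mvfderiv I (fun y ↦ inner ℝ (Z y) (W y)) y (Y y)) x (X x) =
      (inner ℝ (leviCivita I (fun y ↦ leviCivita I Z y (Y y)) x (X x)) (W x) +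
        inner ℝ (leviCivita I Z x (Y x)) (leviCivita I W x (X x))) +
      (inner ℝ (leviCivita I Z x (X x)) (leviCivita I W x (Y x)) +
        inner ℝ (Z x) (leviCivita I (fun y ↦ leviCivita I W y (Y y)) x (X x))) := by
    intro X Y hX hY
    have e : (fun y ↦ mvfderiv I (fun y ↦ inner ℝ (Z y) (W y)) y (Y y)) =ᶠ[𝓝 x]
        (fun y ↦ inner ℝ (leviCivita I Z y (Y y)) (W y) +
          inner ℝ (Z y) (leviCivita I W y (Y y))) := by
      filter_upwards [eventually_mdifferentiableAt h1 hZ, eventually_mdifferentiableAt h1 hW]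
        with y hZy hWy using leviCivita_metric_apply hZy hWy _
    have e' : mvfderiv I (fun y ↦ mvfderiv I (fun y ↦ inner ℝ (Z y) (W y)) y (Y y)) x =
        mvfderiv I (fun y ↦ inner ℝ (leviCivita I Z y (Y y)) (W y) +
          inner ℝ (Z y) (leviCivita I W y (Y y))) x := mvfderiv_congr e
    have hYZ := md (contMDiffAt_leviCivita hY hZ)
    have hYW := md (contMDiffAt_leviCivita hY hW)
    rw [e', mvfderiv_fun_add (mdifferentiableAt_inner hYZ (md hW))
      (mdifferentiableAt_inner (md hZ) hYW), add_apply,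
      leviCivita_metric_apply hYZ (md hW), leviCivita_metric_apply (md hZ) hYW]
  have hc := mvfderiv_mlieBracket ((contMDiffAt_inner (n := ⊤) hZ hW).of_le h2)
    (hX.of_le h2) (hY.of_le h2)
  rw [second hX hY, second hY hX, leviCivita_metric_apply (md hZ) (md hW)] at hc
  simp only [curvatureField, inner_sub_left]
  simp only [real_inner_comm (Z x)] at hc ⊢
  linarith

/-- The curvature tensor may be evaluated through arbitrary smooth extensions. -/
theorem curvatureField_congr {X X' Y Y' Z Z' : Π x : M, TangentSpace I x} {x : M}
    (hX : CMDiffAt ∞ (T% X) x) (hX' : CMDiffAt ∞ (T% X') x) (hXX' : X x = X' x)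
    (hY : CMDiffAt ∞ (T% Y) x) (hY' : CMDiffAt ∞ (T% Y') x) (hYY' : Y x = Y' x)
    (hZ : CMDiffAt ∞ (T% Z) x) (hZ' : CMDiffAt ∞ (T% Z') x) (hZZ' : Z x = Z' x) :
    curvatureField I X Y Z x = curvatureField I X' Y' Z' x := by
  have md : ∀ {X : Π x : M, TangentSpace I x}, CMDiffAt ∞ (T% X) x → MDiffAt (T% X) x :=
    fun h ↦ h.mdifferentiableAt (by simp)
  trans curvatureField I X' Y Z x
  · exact (curvatureField_tensorial_left hZ).pointwise (md hX) (md hX') hXX'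
  trans curvatureField I X' Y' Z x
  · rw [curvatureField_swap, curvatureField_swap X' Y']
    exact congrArg _ <|
      (curvatureField_tensorial_left hZ).pointwise (md hY) (md hY') hYY'
  refine ext_inner_right ℝ fun w ↦ ?_
  have hw : CMDiffAt ∞ (T% (extend E w : Π x : M, TangentSpace I x)) x := contMDiffAt_extend I E w
  have h₁ := inner_curvatureField_skew hX' hY' hZ hw
  have h₂ := inner_curvatureField_skew hX' hY' hZ' hw
  rw [hZZ', ← h₂] at h₁
  simpa using h₁

theorem curvatureField_eq_curvature {X Y Z : Π x : M, TangentSpace I x} {x : M}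
    (hX : CMDiffAt ∞ (T% X) x) (hY : CMDiffAt ∞ (T% Y) x) (hZ : CMDiffAt ∞ (T% Z) x) :
    curvatureField I X Y Z x = curvature I x (X x) (Y x) (Z x) :=
  curvatureField_congr hX (contMDiffAt_extend I E _) (by simp)
    hY (contMDiffAt_extend I E _) (by simp) hZ (contMDiffAt_extend I E _) (by simp)

theorem curvature_swap (x : M) (u v w : TangentSpace I x) :
    curvature I x u v w = -curvature I x v u w :=
  curvatureField_swap _ _ _ _

theorem curvature_add_left (x : M) (u u' v w : TangentSpace I x) :
    curvature I x (u + u') v w = curvature I x u v w + curvature I x u' v w :=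
  (TensorialAt.mkHom _ x (curvatureField_tensorial_left (Y := extend E v)
    (contMDiffAt_extend I E w))).map_add u u'

theorem curvature_smul_left (x : M) (c : ℝ) (u v w : TangentSpace I x) :
    curvature I x (c • u) v w = c • curvature I x u v w :=
  (TensorialAt.mkHom _ x (curvatureField_tensorial_left (Y := extend E v)
    (contMDiffAt_extend I E w))).map_smul c u

theorem inner_curvature_skew (x : M) (u v w z : TangentSpace I x) :
    inner ℝ (curvature I x u v w) z = -inner ℝ (curvature I x u v z) w := by
  have := inner_curvatureField_skew (contMDiffAt_extend I E u) (contMDiffAt_extend I E v)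
    (contMDiffAt_extend I E w) (contMDiffAt_extend I E z)
  simpa [curvature] using this

/-- The quadratic form of the curvature tensor in two dimensional subspaces. -/
theorem inner_curvature_of_mem_plane (x : M) (e f : TangentSpace I x) (a b c d : ℝ) :
    inner ℝ (curvature I x (a • e + b • f) (c • e + d • f) (c • e + d • f)) (a • e + b • f) =
      (a * d - b * c) ^ 2 * inner ℝ (curvature I x e f f) e := by
  have self : ∀ u w, curvature I x u u w = 0 := fun u w ↦ by
    have h := curvature_swap x u u w
    have h2 : (2 : ℝ) • curvature I x u u w = 0 := by
      rw [two_smul]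
      nth_rewrite 1 [h]
      simp
    simpa using h2
  have h : ∀ w, curvature I x (a • e + b • f) (c • e + d • f) w =
      (a * d - b * c) • curvature I x e f w := by
    intro w
    rw [curvature_add_left, curvature_smul_left, curvature_smul_left, curvature_swap x e,
      curvature_swap x f, curvature_add_left, curvature_add_left, curvature_smul_left,
      curvature_smul_left, curvature_smul_left, curvature_smul_left, self, self,
      curvature_swap x f e]
    module
  have self' : ∀ w, inner ℝ (curvature I x e f w) w = 0 := fun w ↦
    self_eq_neg.1 (inner_curvature_skew x e f w w)
  rw [h, real_inner_smul_left, inner_add_right, real_inner_smul_right, real_inner_smul_right,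
    inner_curvature_skew x e f _ e, inner_curvature_skew x e f _ f, inner_add_right,
    inner_add_right, real_inner_smul_right, real_inner_smul_right, real_inner_smul_right,
    real_inner_smul_right, self', self', inner_curvature_skew x e f e f]
  ring

theorem gram_of_mem_plane {T : Type*} [NormedAddCommGroup T] [InnerProductSpace ℝ T]
    (e f : T) (a b c d : ℝ) :
    ‖a • e + b • f‖ ^ 2 * ‖c • e + d • f‖ ^ 2 - inner ℝ (a • e + b • f) (c • e + d • f) ^ 2 =
      (a * d - b * c) ^ 2 * (‖e‖ ^ 2 * ‖f‖ ^ 2 - inner ℝ e f ^ 2) := by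
  simp only [← real_inner_self_eq_norm_sq, inner_add_left, inner_add_right, real_inner_smul_left,
    real_inner_smul_right, real_inner_comm e f]
  ring

theorem gram_pos_of_linearIndependent {T : Type*} [NormedAddCommGroup T] [InnerProductSpace ℝ T]
    {u v : T} (h : LinearIndependent ℝ ![u, v]) :
    0 < ‖u‖ ^ 2 * ‖v‖ ^ 2 - inner ℝ u v ^ 2 := by
  have := (Matrix.posDef_gram_of_linearIndependent h).det_pos
  simpa [Matrix.det_fin_two, Matrix.gram_apply, real_inner_self_eq_norm_sq, real_inner_comm u v,
    sq (inner ℝ u v)] using this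

end Curvature

section Surface

variable {B : Type*} [TopologicalSpace B] [ChartedSpace (EuclideanSpace ℝ (Fin 2)) B]
  [IsManifold (𝓡 2) ∞ B] [RiemannianBundle (fun b : B ↦ TangentSpace (𝓡 2) b)]
  [IsContMDiffRiemannianBundle (𝓡 2) ∞ (EuclideanSpace ℝ (Fin 2))
    (fun b : B ↦ TangentSpace (𝓡 2) b)]

/-- The Gauss curvature may be computed in any basis of the tangent plane. -/
theorem gaussCurvature_eq_sectionalCurvature {b : B} {u v : TangentSpace (𝓡 2) b}
    (h : LinearIndependent ℝ ![u, v]) :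
    gaussCurvature b = sectionalCurvature (𝓡 2) b u v := by
  have dec : ∀ w : EuclideanSpace ℝ (Fin 2), w = w 0 • EuclideanSpace.single 0 (1 : ℝ)
      + w 1 • EuclideanSpace.single 1 (1 : ℝ) := fun w ↦ by
    ext i; fin_cases i <;> simp
  obtain ⟨e, he⟩ : ∃ e : TangentSpace (𝓡 2) b,
    e = (EuclideanSpace.single 0 1 : EuclideanSpace ℝ (Fin 2)) := ⟨_, rfl⟩
  obtain ⟨f, hf⟩ : ∃ f : TangentSpace (𝓡 2) b,
    f = (EuclideanSpace.single 1 1 : EuclideanSpace ℝ (Fin 2)) := ⟨_, rfl⟩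
  have hdec : ∀ w : TangentSpace (𝓡 2) b, ∃ a c : ℝ, w = a • e + c • f := fun w ↦
    ⟨_, _, by rw [he, hf]; exact dec w⟩
  obtain ⟨a, c, hu⟩ := hdec u
  obtain ⟨a', c', hv⟩ := hdec v
  have hpos := gram_pos_of_linearIndependent h
  have hgc : gaussCurvature b = sectionalCurvature (𝓡 2) b e f := by rw [he, hf]; rfl
  rw [hu, hv, gram_of_mem_plane] at hpos
  have hne : (a * c' - c * a') ^ 2 ≠ 0 := fun h0 ↦ by simp [h0] at hpos
  rw [hgc, sectionalCurvature, sectionalCurvature, hu, hv, gram_of_mem_plane,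
    inner_curvature_of_mem_plane, mul_div_mul_left _ _ hne]

end Surface

section Related

/-- The vector field `X` is `C^n` at `x`. -/
abbrev ContMDiffFieldAt {E : Type*} [NormedAddCommGroup E] [NormedSpace ℝ E] {H : Type*}
    [TopologicalSpace H] (I : ModelWithCorners ℝ E H) {M : Type*} [TopologicalSpace M]
    [ChartedSpace H M] [IsManifold I ∞ M] (n : ℕ∞ω) (X : Π x : M, TangentSpace I x) (x : M) :
    Prop :=
  ContMDiffAt I I.tangent n (fun y ↦ (⟨y, X y⟩ : TangentBundle I M)) x


variable {E : Type*} [NormedAddCommGroup E] [NormedSpace ℝ E] [FiniteDimensional ℝ E]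
  {H : Type*} [TopologicalSpace H] {I : ModelWithCorners ℝ E H}
  {M : Type*} [TopologicalSpace M] [ChartedSpace H M] [IsManifold I ∞ M]
  {E' : Type*} [NormedAddCommGroup E'] [NormedSpace ℝ E'] [FiniteDimensional ℝ E']
  {H' : Type*} [TopologicalSpace H'] {I' : ModelWithCorners ℝ E' H'}
  {M' : Type*} [TopologicalSpace M'] [ChartedSpace H' M'] [IsManifold I' ∞ M']

set_option linter.unusedSectionVars false in
/-- Tangent vectors are separated by the derivatives of functions. -/
theorem tangentVector_ext_mvfderiv {y : M'} {v w : TangentSpace I' y}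
    (h : ∀ f : M' → ℝ, CMDiffAt 2 f y → mvfderiv I' f y v = mvfderiv I' f y w) : v = w := by
  have hc : CMDiffAt 2 (extChartAt I' y) y := contMDiffAt_extChartAt
  have hinj : Function.Injective (mfderiv I' 𝓘(ℝ, E') (extChartAt I' y) y) :=
    (isInvertible_mfderiv_extChartAt (mem_extChartAt_source y)).injective
  apply hinj
  refine (SeparatingDual.eq_iff_forall_dual_eq (R := ℝ) (V := E')).2 fun ℓ ↦ ?_
  have hℓ : ContMDiff 𝓘(ℝ, E') 𝓘(ℝ, ℝ) 2 ℓ := ℓ.contMDiff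
  have key : ∀ u : TangentSpace I' y, mvfderiv I' (ℓ ∘ extChartAt I' y) y u =
      ℓ (mfderiv I' 𝓘(ℝ, E') (extChartAt I' y) y u) := by
    intro u
    rw [mvfderiv_comp_apply y (hℓ.mdifferentiableAt two_ne_zero)
      (hc.mdifferentiableAt two_ne_zero)]
    simp only [mvfderiv, mfderiv_eq_fderiv, ContinuousLinearMap.fderiv]
    rfl
  have := h (ℓ ∘ extChartAt I' y) (hℓ.contMDiffAt.comp y hc)
  rwa [key, key] at this

variable [Nontrivial E] [Nontrivial E']
  [RiemannianBundle (fun x : M ↦ TangentSpace I x)]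
  [IsContMDiffRiemannianBundle I ∞ E (fun x : M ↦ TangentSpace I x)]
  [RiemannianBundle (fun x : M' ↦ TangentSpace I' x)]
  [IsContMDiffRiemannianBundle I' ∞ E' (fun x : M' ↦ TangentSpace I' x)]

/-- The Lie brackets of related vector fields are related. -/
theorem mfderiv_mlieBracket_of_related {g : M → M'} {X Y : Π x : M, TangentSpace I x}
    {X' Y' : Π x : M', TangentSpace I' x} {x : M} (hg : CMDiffAt 2 g x)
    (hX : CMDiffAt 2 (T% X) x) (hY : CMDiffAt 2 (T% Y) x)
    (hX' : CMDiffAt 2 (T% X') (g x)) (hY' : CMDiffAt 2 (T% Y') (g x))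
    (hXX' : ∀ᶠ y in 𝓝 x, mfderiv I I' g y (X y) = X' (g y))
    (hYY' : ∀ᶠ y in 𝓝 x, mfderiv I I' g y (Y y) = Y' (g y)) :
    mfderiv I I' g x (mlieBracket I X Y x) = mlieBracket I' X' Y' (g x) := by
  refine tangentVector_ext_mvfderiv fun f hf ↦ ?_
  have hgd : MDiffAt g x := hg.mdifferentiableAt two_ne_zero
  have e12 : ((1 : ℕ∞) + 1) ≤ 2 := by norm_num
  have hgev : ∀ᶠ y in 𝓝 x, MDiffAt g y :=
    ((contMDiffAt_iff_contMDiffAt_nhds (by simp)).1 hg).mono fun _ h ↦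
      h.mdifferentiableAt two_ne_zero
  have hfev : ∀ᶠ y in 𝓝 x, MDiffAt f (g y) :=
    hgd.continuousAt.eventually (eventually_mdifferentiableAt_fun (by norm_num) hf)
  have second : ∀ {X Y : Π x : M, TangentSpace I x} {X' Y' : Π x : M', TangentSpace I' x},
      CMDiffAt 2 (T% Y') (g x) →
      (∀ᶠ y in 𝓝 x, mfderiv I I' g y (X y) = X' (g y)) →
      (∀ᶠ y in 𝓝 x, mfderiv I I' g y (Y y) = Y' (g y)) →
      mvfderiv I (fun y ↦ mvfderiv I (f ∘ g) y (Y y)) x (X x) =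
        mvfderiv I' (fun y ↦ mvfderiv I' f y (Y' y)) (g x) (X' (g x)) := by
    intro X Y X' Y' hY' hXX' hYY'
    have e : (fun y ↦ mvfderiv I (f ∘ g) y (Y y)) =ᶠ[𝓝 x]
        (fun y ↦ mvfderiv I' f y (Y' y)) ∘ g := by
      filter_upwards [hgev, hfev, hYY'] with y hgy hfy hYy
      rw [mvfderiv_comp_apply y hfy hgy, hYy]
      rfl
    rw [mvfderiv_congr e, mvfderiv_comp_apply x
      ((contMDiffAt_mvfderiv_apply e12 hf hY').mdifferentiableAt (by simp)) hgd,
      hXX'.self_of_nhds]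
  rw [← mvfderiv_comp_apply x (hf.mdifferentiableAt two_ne_zero) hgd,
    mvfderiv_mlieBracket (hf.comp x hg) hX hY, mvfderiv_mlieBracket hf hX' hY',
    second hY' hXX' hYY', second hX' hYY' hXX']

end Related

section Submersion

set_option linter.unusedSectionVars false

variable {M : Type*} [TopologicalSpace M] [ChartedSpace (EuclideanSpace ℝ (Fin 3)) M]
  [IsManifold (𝓡 3) ∞ M] [RiemannianBundle (fun x : M ↦ TangentSpace (𝓡 3) x)]
  [IsContMDiffRiemannianBundle (𝓡 3) ∞ (EuclideanSpace ℝ (Fin 3))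
    (fun x : M ↦ TangentSpace (𝓡 3) x)]
  {B : Type*} [TopologicalSpace B] [ChartedSpace (EuclideanSpace ℝ (Fin 2)) B]
  [IsManifold (𝓡 2) ∞ B] [RiemannianBundle (fun b : B ↦ TangentSpace (𝓡 2) b)]
  [IsContMDiffRiemannianBundle (𝓡 2) ∞ (EuclideanSpace ℝ (Fin 2))
    (fun b : B ↦ TangentSpace (𝓡 2) b)]
  {pr : M → B} {ξ : Π x : M, TangentSpace (𝓡 3) x}

/-- The horizontal lift of a vector field along a Riemannian submersion. -/
def horizontalLift (pr : M → B) (W : Π b : B, TangentSpace (𝓡 2) b) (q : M) :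
    TangentSpace (𝓡 3) q :=
  ContinuousLinearMap.adjoint (mfderiv (𝓡 3) (𝓡 2) pr q) (W (pr q))

theorem inner_horizontalLift (W : Π b : B, TangentSpace (𝓡 2) b) (q : M)
    (z : TangentSpace (𝓡 3) q) :
    inner ℝ (horizontalLift pr W q) z = inner ℝ (W (pr q)) (mfderiv (𝓡 3) (𝓡 2) pr q z) :=
  ContinuousLinearMap.adjoint_inner_left _ _ _

theorem contMDiffAt_horizontalLift (hpr : ContMDiff (𝓡 3) (𝓡 2) ∞ pr)
    {W : Π b : B, TangentSpace (𝓡 2) b} {q : M} (hW : ContMDiffFieldAt (𝓡 2) ∞ W (pr q)) :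
    ContMDiffFieldAt (𝓡 3) ∞ (horizontalLift pr W) q := by
  refine contMDiffAt_of_inner (n := ⊤) fun Z hZ ↦ ?_
  simp only [inner_horizontalLift]
  have h₁ : ContMDiffAt (𝓡 3) (𝓡 2).tangent ∞
      (fun y ↦ (⟨pr y, W (pr y)⟩ : TangentBundle (𝓡 2) B)) q :=
    hW.comp q hpr.contMDiffAt
  have h₂ : ContMDiffAt (𝓡 3) (𝓡 2).tangent ∞
      (fun y ↦ (⟨pr y, mfderiv (𝓡 3) (𝓡 2) pr y (Z y)⟩ : TangentBundle (𝓡 2) B)) q :=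
    ((hpr.contMDiff_tangentMap (m := ∞) le_rfl).contMDiffAt).comp q hZ
  exact ContMDiffAt.inner_bundle (IB := 𝓡 2) (F := EuclideanSpace ℝ (Fin 2))
    (E := fun b : B ↦ TangentSpace (𝓡 2) b) (b := pr) h₁ h₂

namespace IsKillingSubmersion

variable (h : IsKillingSubmersion pr ξ)
include h

theorem mdifferentiableAt (q : M) : MDifferentiableAt (𝓡 3) (𝓡 2) pr q :=
  h.submersion.smooth.mdifferentiableAt (by simp)

/-- The Killing field is vertical. -/
theorem mfderiv_killing (q : M) : mfderiv (𝓡 3) (𝓡 2) pr q (ξ q) = 0 := by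
  have hq : q ∈ trajectory (𝓡 3) ξ q := by
    rw [← h.fiber_eq]
    rfl
  obtain ⟨γ, s, hs, hs', h0, hγ, hγ0, -⟩ := hq
  have hconst : ∀ t ∈ s, pr (γ t) = pr q := by
    intro t ht
    have : γ t ∈ trajectory (𝓡 3) ξ q := ⟨γ, s, hs, hs', h0, hγ, hγ0, t, ht, rfl⟩
    rw [← h.fiber_eq] at this
    exact this
  have hd : HasMFDerivAt 𝓘(ℝ, ℝ) (𝓡 3) γ 0 ((1 : ℝ →L[ℝ] ℝ).smulRight (ξ (γ 0))) :=
    (hγ 0 h0).hasMFDerivAt (hs.mem_nhds h0)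
  have hcomp := HasMFDerivAt.comp 0 (h.mdifferentiableAt (γ 0)).hasMFDerivAt hd
  have hc : HasMFDerivAt 𝓘(ℝ, ℝ) (𝓡 2) (pr ∘ γ) 0 0 :=
    (hasMFDerivAt_const (pr q) (0 : ℝ)).congr_of_eventuallyEq
      (Filter.eventuallyEq_of_mem (hs.mem_nhds h0) hconst)
  have := congr($(hasMFDerivAt_unique hcomp hc) (1 : ℝ))
  subst hγ0
  change mfderiv (𝓡 3) (𝓡 2) pr (γ 0) ((1 : ℝ) • ξ (γ 0)) = 0 at this
  rwa [one_smul] at this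

theorem inner_killing_self (q : M) : inner ℝ (ξ q) (ξ q) = 1 := by
  rw [real_inner_self_eq_norm_sq, h.unit, one_pow]

theorem killing_ne_zero (q : M) : ξ q ≠ 0 := by
  rw [← norm_ne_zero_iff, h.unit]
  exact one_ne_zero

theorem exists_smul_of_mfderiv_eq_zero {q : M} {w : TangentSpace (𝓡 3) q}
    (hw : mfderiv (𝓡 3) (𝓡 2) pr q w = 0) : ∃ c : ℝ, c • ξ q = w := by
  set D := (mfderiv (𝓡 3) (𝓡 2) pr q).toLinearMap
  have hker : Module.finrank ℝ (LinearMap.ker D) = 1 := by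
    have h₁ := LinearMap.finrank_range_add_finrank_ker D
    have h₂ : LinearMap.range D = ⊤ := LinearMap.range_eq_top.2 (h.submersion.mfderiv_surjective q)
    have h₃ : Module.finrank ℝ (TangentSpace (𝓡 3) q) = 3 := Fact.out
    have h₄ : Module.finrank ℝ (TangentSpace (𝓡 2) (pr q)) = 2 :=
      (finrank_euclideanSpace_fin : Module.finrank ℝ (EuclideanSpace ℝ (Fin 2)) = 2)
    rw [h₂, finrank_top, h₃, h₄] at h₁
    omega
  have hξ : (⟨ξ q, h.mfderiv_killing q⟩ : LinearMap.ker D) ≠ 0 := fun h0 ↦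
    h.killing_ne_zero q (congrArg Subtype.val h0)
  obtain ⟨c, hc⟩ := (finrank_eq_one_iff_of_nonzero' _ hξ).1 hker ⟨w, hw⟩
  exact ⟨c, congrArg Subtype.val hc⟩

theorem isHorizontal_iff {q : M} {u : TangentSpace (𝓡 3) q} :
    IsHorizontal pr q u ↔ inner ℝ u (ξ q) = 0 := by
  refine ⟨fun hu ↦ hu _ (h.mfderiv_killing q), fun hu w hw ↦ ?_⟩
  obtain ⟨c, rfl⟩ := h.exists_smul_of_mfderiv_eq_zero hw
  rw [real_inner_smul_right, hu, mul_zero]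

theorem inner_mfderiv_mfderiv {q : M} {u v : TangentSpace (𝓡 3) q}
    (hu : inner ℝ u (ξ q) = 0) (hv : inner ℝ v (ξ q) = 0) :
    inner ℝ (mfderiv (𝓡 3) (𝓡 2) pr q u) (mfderiv (𝓡 3) (𝓡 2) pr q v) = inner ℝ u v := by
  have hn : ∀ w : TangentSpace (𝓡 3) q, inner ℝ w (ξ q) = 0 →
      ‖mfderiv (𝓡 3) (𝓡 2) pr q w‖ = ‖w‖ := fun w hw ↦
    h.submersion.norm_mfderiv q w (h.isHorizontal_iff.2 hw)
  have huv : inner ℝ (u + v) (ξ q) = 0 := by rw [inner_add_left, hu, hv, add_zero]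
  rw [real_inner_eq_norm_add_mul_self_sub_norm_mul_self_sub_norm_mul_self_div_two,
    real_inner_eq_norm_add_mul_self_sub_norm_mul_self_sub_norm_mul_self_div_two, ← map_add,
    hn _ huv, hn _ hu, hn _ hv]

theorem adjoint_mfderiv_apply {q : M} (w : TangentSpace (𝓡 3) q) :
    ContinuousLinearMap.adjoint (mfderiv (𝓡 3) (𝓡 2) pr q) (mfderiv (𝓡 3) (𝓡 2) pr q w) =
      w - inner ℝ w (ξ q) • ξ q := by
  have hor : ∀ z : TangentSpace (𝓡 3) q, inner ℝ (z - inner ℝ z (ξ q) • ξ q) (ξ q) = 0 := fun z ↦ by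
    rw [inner_sub_left, real_inner_smul_left, h.inner_killing_self, mul_one, sub_self]
  have hD : ∀ z : TangentSpace (𝓡 3) q, mfderiv (𝓡 3) (𝓡 2) pr q z =
      mfderiv (𝓡 3) (𝓡 2) pr q (z - inner ℝ z (ξ q) • ξ q) := fun z ↦ by
    rw [map_sub, map_smul, h.mfderiv_killing, smul_zero, sub_zero]
  refine ext_inner_right ℝ fun z ↦ ?_
  rw [ContinuousLinearMap.adjoint_inner_left, hD w, hD z, h.inner_mfderiv_mfderiv (hor w) (hor z),
    inner_sub_right, real_inner_smul_right, hor, mul_zero, sub_zero]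

theorem horizontalLift_of_related {W : Π b : B, TangentSpace (𝓡 2) b} {q : M}
    {w : TangentSpace (𝓡 3) q} (hw : mfderiv (𝓡 3) (𝓡 2) pr q w = W (pr q)) :
    horizontalLift pr W q = w - inner ℝ w (ξ q) • ξ q := by
  rw [horizontalLift, ← hw, h.adjoint_mfderiv_apply]

theorem inner_horizontalLift_killing (W : Π b : B, TangentSpace (𝓡 2) b) (q : M) :
    inner ℝ (horizontalLift pr W q) (ξ q) = 0 := by
  rw [inner_horizontalLift, h.mfderiv_killing, inner_zero_right]

theorem mfderiv_horizontalLift (W : Π b : B, TangentSpace (𝓡 2) b) (q : M) :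
    mfderiv (𝓡 3) (𝓡 2) pr q (horizontalLift pr W q) = W (pr q) := by
  obtain ⟨w, hw⟩ := h.submersion.mfderiv_surjective q (W (pr q))
  rw [h.horizontalLift_of_related hw, map_sub, map_smul, h.mfderiv_killing, smul_zero, sub_zero, hw]

theorem inner_horizontalLift_horizontalLift (W Z : Π b : B, TangentSpace (𝓡 2) b) (q : M) :
    inner ℝ (horizontalLift pr W q) (horizontalLift pr Z q) = inner ℝ (W (pr q)) (Z (pr q)) := by
  rw [inner_horizontalLift, h.mfderiv_horizontalLift]

/-- The Koszul form of horizontal lifts is the Koszul form of the base. -/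
theorem koszul_horizontalLift {X Y Z : Π b : B, TangentSpace (𝓡 2) b} {q : M}
    (hX : ContMDiffFieldAt (𝓡 2) 2 X (pr q)) (hY : ContMDiffFieldAt (𝓡 2) 2 Y (pr q))
    (hZ : ContMDiffFieldAt (𝓡 2) 2 Z (pr q)) (hX' : ContMDiffFieldAt (𝓡 3) 2 (horizontalLift pr X) q)
    (hY' : ContMDiffFieldAt (𝓡 3) 2 (horizontalLift pr Y) q)
    (hZ' : ContMDiffFieldAt (𝓡 3) 2 (horizontalLift pr Z) q) :
    koszul (𝓡 3) (horizontalLift pr X) (horizontalLift pr Y) (horizontalLift pr Z) q =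
      koszul (𝓡 2) X Y Z (pr q) := by
  have d : ∀ {X Y Z : Π b : B, TangentSpace (𝓡 2) b}, ContMDiffFieldAt (𝓡 2) 2 Y (pr q) →
      ContMDiffFieldAt (𝓡 2) 2 Z (pr q) →
      mvfderiv (𝓡 3) (fun y ↦ inner ℝ (horizontalLift pr Y y) (horizontalLift pr Z y)) q
        (horizontalLift pr X q) =
      mvfderiv (𝓡 2) (fun y ↦ inner ℝ (Y y) (Z y)) (pr q) (X (pr q)) := by
    intro X Y Z hY hZ
    simp only [h.inner_horizontalLift_horizontalLift]
    have := mvfderiv_comp_apply q (mdifferentiableAt_inner (hY.mdifferentiableAt two_ne_zero)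
      (hZ.mdifferentiableAt two_ne_zero)) (h.mdifferentiableAt q) (horizontalLift pr X q)
    rw [h.mfderiv_horizontalLift] at this
    exact this
  have l : ∀ {X Y Z : Π b : B, TangentSpace (𝓡 2) b}, ContMDiffFieldAt (𝓡 2) 2 X (pr q) →
      ContMDiffFieldAt (𝓡 2) 2 Y (pr q) → ContMDiffFieldAt (𝓡 3) 2 (horizontalLift pr X) q →
      ContMDiffFieldAt (𝓡 3) 2 (horizontalLift pr Y) q →
      inner ℝ (mlieBracket (𝓡 3) (horizontalLift pr X) (horizontalLift pr Y) q)
        (horizontalLift pr Z q) = inner ℝ (mlieBracket (𝓡 2) X Y (pr q)) (Z (pr q)) := by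
    intro X Y Z hX hY hX' hY'
    rw [real_inner_comm, inner_horizontalLift, mfderiv_mlieBracket_of_related
      ((h.submersion.smooth.contMDiffAt).of_le ENat.LEInfty.out) hX' hY' hX hY
      (.of_forall (h.mfderiv_horizontalLift X)) (.of_forall (h.mfderiv_horizontalLift Y)),
      real_inner_comm]
  rw [koszul, koszul, d hY hZ, d hX hZ, d hX hY, l hX hY hX' hY', l hX hZ hX' hZ', l hY hZ hY' hZ']

/-- The covariant derivative of horizontal lifts projects to that of the base. -/
theorem mfderiv_leviCivita_horizontalLift {X Y : Π b : B, TangentSpace (𝓡 2) b} {q : M}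
    (hX : ContMDiffFieldAt (𝓡 2) 2 X (pr q)) (hY : ContMDiffFieldAt (𝓡 2) 2 Y (pr q))
    (hX' : ContMDiffFieldAt (𝓡 3) 2 (horizontalLift pr X) q)
    (hY' : ContMDiffFieldAt (𝓡 3) 2 (horizontalLift pr Y) q) :
    mfderiv (𝓡 3) (𝓡 2) pr q
        (leviCivita (𝓡 3) (horizontalLift pr Y) q (horizontalLift pr X q)) =
      leviCivita (𝓡 2) Y (pr q) (X (pr q)) := by
  refine ext_inner_right ℝ fun z ↦ ?_
  set Z : Π b : B, TangentSpace (𝓡 2) b := extend (EuclideanSpace ℝ (Fin 2)) z with hZdef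
  have hZ : ContMDiffFieldAt (𝓡 2) ∞ Z (pr q) := contMDiffAt_extend _ _ z
  have hZ' := contMDiffAt_horizontalLift h.submersion.smooth hZ
  have hz : Z (pr q) = z := extend_apply_self _ _
  rw [← hz, real_inner_comm, ← inner_horizontalLift, real_inner_comm,
    inner_leviCivita (hX'.mdifferentiableAt two_ne_zero) (hY'.mdifferentiableAt two_ne_zero)
      (hZ'.mdifferentiableAt (by simp)),
    inner_leviCivita (hX.mdifferentiableAt two_ne_zero) (hY.mdifferentiableAt two_ne_zero)
      (hZ.mdifferentiableAt (by simp)),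
    h.koszul_horizontalLift hX hY (hZ.of_le ENat.LEInfty.out) hX' hY'
      (hZ'.of_le ENat.LEInfty.out)]

end IsKillingSubmersion

end Submersion

section Killing

set_option linter.unusedSectionVars false

variable {E : Type*} [NormedAddCommGroup E] [NormedSpace ℝ E] [FiniteDimensional ℝ E]
  {H : Type*} [TopologicalSpace H] {I : ModelWithCorners ℝ E H}
  {M : Type*} [TopologicalSpace M] [ChartedSpace H M] [IsManifold I ∞ M]
  [RiemannianBundle (fun x : M ↦ TangentSpace I x)]
  [IsContMDiffRiemannianBundle I ∞ E (fun x : M ↦ TangentSpace I x)]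
  {ξ : Π x : M, TangentSpace I x}

namespace IsKilling

variable (hξ : IsKilling I ξ)
include hξ

theorem mdifferentiableAt (x : M) : MDiffAt (T% ξ) x :=
  hξ.smooth.mdifferentiableAt (by simp)

/-- The covariant derivative of a Killing field is skew-symmetric. -/
theorem inner_leviCivita_skew (x : M) (u w : TangentSpace I x) :
    inner ℝ (leviCivita I ξ x u) w = -inner ℝ (leviCivita I ξ x w) u := by
  have hu := mdifferentiableAt_extend I E (V := (TangentSpace I : M → Type _)) u
  have hw := mdifferentiableAt_extend I E (V := (TangentSpace I : M → Type _)) w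
  have h₁ := hξ.lie_metric x _ _ hu hw
  rw [leviCivita_metric_apply hu hw, ← leviCivita_sub_swap (hξ.mdifferentiableAt x) hu,
    ← leviCivita_sub_swap (hξ.mdifferentiableAt x) hw] at h₁
  simp only [extend_apply_self, inner_sub_left, inner_sub_right] at h₁
  rw [real_inner_comm _ (leviCivita I ξ x w)]
  linarith

theorem inner_leviCivita_self (x : M) (u : TangentSpace I x) :
    inner ℝ (leviCivita I ξ x u) u = 0 :=
  self_eq_neg.1 (hξ.inner_leviCivita_skew x u u)

variable (hu : ∀ x, ‖ξ x‖ = 1)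
include hu

theorem inner_leviCivita_killing (x : M) (u : TangentSpace I x) :
    inner ℝ (leviCivita I ξ x u) (ξ x) = 0 := by
  have h := leviCivita_metric_apply (hξ.mdifferentiableAt x) (hξ.mdifferentiableAt x) u
  simp only [real_inner_self_eq_norm_sq, hu, mvfderiv_const, zero_apply] at h
  rw [real_inner_comm _ (ξ x)] at h
  linarith

/-- The trajectories of a unit Killing field are geodesics. -/
theorem leviCivita_killing (x : M) : leviCivita I ξ x (ξ x) = 0 := by
  refine ext_inner_right ℝ fun w ↦ ?_
  rw [hξ.inner_leviCivita_skew, hξ.inner_leviCivita_killing hu, inner_zero_left, neg_zero]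

theorem inner_curvature_killing [Nontrivial E] (x : M) (u : TangentSpace I x) :
    inner ℝ (curvature I x u (ξ x) (ξ x)) u = ‖leviCivita I ξ x u‖ ^ 2 := by
  set X : Π x : M, TangentSpace I x := extend E u with hX_def
  have hX : CMDiffAt ∞ (T% X) x := contMDiffAt_extend I E u
  have hXx : X x = u := extend_apply_self _ _
  have hXd : MDiffAt (T% X) x := hX.mdifferentiableAt (by simp)
  have hξx : CMDiffAt ∞ (T% ξ) x := hξ.smooth x
  have hgeo : (fun y ↦ leviCivita I ξ y (ξ y)) = 0 := funext (hξ.leviCivita_killing hu)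
  have hd := leviCivita_metric_apply (mdifferentiableAt_leviCivita hXd hξx) hXd (ξ x)
  simp only [hξ.inner_leviCivita_self, mvfderiv_const, zero_apply] at hd
  have hbr := leviCivita_sub_swap hXd (hξ.mdifferentiableAt x)
  have hR := curvatureField_eq_curvature hX hξx hξx
  rw [hXx] at hR hbr hd
  rw [← hR, curvatureField, hgeo, CovariantDerivative.zero, ← hbr]
  simp only [Pi.zero_apply, zero_apply, zero_sub, inner_sub_left, inner_neg_left, hXx]
  rw [hξ.inner_leviCivita_skew x (_ - _) u, inner_sub_right, real_inner_self_eq_norm_sq]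
  linarith

end IsKilling

end Killing

section CrossProduct

set_option linter.unusedSectionVars false

variable {M : Type*} [TopologicalSpace M] [ChartedSpace (EuclideanSpace ℝ (Fin 3)) M]
  [IsManifold (𝓡 3) ∞ M] [RiemannianBundle (fun x : M ↦ TangentSpace (𝓡 3) x)]

theorem exists_orthonormalBasis_of_norm_eq_one {x : M} {n : TangentSpace (𝓡 3) x}
    (hn : ‖n‖ = 1) : ∃ b : OrthonormalBasis (Fin 3) ℝ (TangentSpace (𝓡 3) x), b 2 = n := by
  have hv : Orthonormal ℝ (({2} : Set (Fin 3)).domRestrict fun _ ↦ n) :=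
    ⟨fun _ ↦ hn, fun i j hij ↦ (hij (Subsingleton.elim i j)).elim⟩
  have hcard : Module.finrank ℝ (TangentSpace (𝓡 3) x) = Fintype.card (Fin 3) := by
    rw [Fintype.card_fin]
    exact Fact.out
  obtain ⟨b, hb⟩ := hv.exists_orthonormalBasis_extension_of_card_eq hcard
  exact ⟨b, hb 2 rfl⟩

theorem exists_inner_cross_eq (o : ManifoldOrientation M) {x : M}
    (b : OrthonormalBasis (Fin 3) ℝ (TangentSpace (𝓡 3) x)) :
    ∃ d : ℝ, d ^ 2 = 1 ∧ ∀ u w, inner ℝ (cross o u (b 2)) w =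
      d * (inner ℝ (b 0) u * inner ℝ (b 1) w - inner ℝ (b 1) u * inner ℝ (b 0) w) := by
  have hdet : ∀ u w, b.toBasis.det ![u, b 2, w] =
      -(inner ℝ (b 0) u * inner ℝ (b 1) w - inner ℝ (b 1) u * inner ℝ (b 0) w) := by
    intro u w
    simp only [Module.Basis.det_apply, Matrix.det_fin_three, Module.Basis.toMatrix_apply,
      OrthonormalBasis.coe_toBasis_repr_apply, OrthonormalBasis.repr_apply_apply,
      orthonormal_iff_ite.1 b.orthonormal, Matrix.cons_val_zero, Matrix.cons_val_one,
      Matrix.cons_val]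
    simp
    ring
  by_cases ho : b.toBasis.orientation = o.orient x
  · refine ⟨-1, by norm_num, fun u w ↦ ?_⟩
    rw [inner_cross, (o.orient x).volumeForm_robust b ho, hdet]
    ring
  · refine ⟨1, by norm_num, fun u w ↦ ?_⟩
    rw [inner_cross, (o.orient x).volumeForm_robust_neg b ho, AlternatingMap.neg_apply,
      hdet]
    ring

theorem norm_sq_cross (o : ManifoldOrientation M) {x : M} {n : TangentSpace (𝓡 3) x}
    (hn : ‖n‖ = 1) (u : TangentSpace (𝓡 3) x) :
    ‖cross o u n‖ ^ 2 = ‖u‖ ^ 2 - inner ℝ u n ^ 2 := by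
  obtain ⟨b, rfl⟩ := exists_orthonormalBasis_of_norm_eq_one hn
  obtain ⟨d, hd, h⟩ := exists_inner_cross_eq o b
  rw [← b.sum_sq_norm_inner_left, ← b.sum_sq_norm_inner_right u, real_inner_comm _ u]
  simp only [Fin.sum_univ_three, h, orthonormal_iff_ite.1 b.orthonormal, Real.norm_eq_abs, sq_abs]
  simp
  linear_combination (inner ℝ (b 0) u ^ 2 + inner ℝ (b 1) u ^ 2) * hd

theorem inner_cross_sq (o : ManifoldOrientation M) {x : M} {n : TangentSpace (𝓡 3) x}
    (hn : ‖n‖ = 1) {u v : TangentSpace (𝓡 3) x} (hu : inner ℝ u n = 0) (hv : inner ℝ v n = 0) :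
    inner ℝ (cross o u n) v ^ 2 = ‖u‖ ^ 2 * ‖v‖ ^ 2 - inner ℝ u v ^ 2 := by
  obtain ⟨b, rfl⟩ := exists_orthonormalBasis_of_norm_eq_one hn
  obtain ⟨d, hd, h⟩ := exists_inner_cross_eq o b
  rw [h, ← b.sum_sq_norm_inner_right u, ← b.sum_sq_norm_inner_right v,
    ← b.sum_inner_mul_inner u v]
  simp only [Fin.sum_univ_three, Real.norm_eq_abs, sq_abs, hu, real_inner_comm _ (b 2), hv,
    real_inner_comm (b 0) u, real_inner_comm (b 1) u]
  linear_combination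
    (inner ℝ (b 0) u * inner ℝ (b 1) v - inner ℝ (b 1) u * inner ℝ (b 0) v) ^ 2 * hd

/-- A skew-symmetric endomorphism vanishing on the normal `n` is a multiple of `u ↦ u ∧ n`. -/
theorem exists_eq_smul_cross (o : ManifoldOrientation M) {x : M} {n : TangentSpace (𝓡 3) x}
    (hn : ‖n‖ = 1) (S : TangentSpace (𝓡 3) x →L[ℝ] TangentSpace (𝓡 3) x)
    (hS : ∀ u w, inner ℝ (S u) w = -inner ℝ (S w) u) (hSn : S n = 0) :
    ∃ t : ℝ, ∀ u, S u = t • cross o u n := by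
  obtain ⟨b, rfl⟩ := exists_orthonormalBasis_of_norm_eq_one hn
  obtain ⟨d, hd, h⟩ := exists_inner_cross_eq o b
  refine ⟨inner ℝ (S (b 0)) (b 1) * d, fun u ↦ ext_inner_right ℝ fun w ↦ ?_⟩
  have self : ∀ v, inner ℝ (S v) v = 0 := fun v ↦ self_eq_neg.1 (hS v v)
  have h2 : ∀ v, inner ℝ (S v) (b 2) = 0 := fun v ↦ by rw [hS, hSn, inner_zero_left, neg_zero]
  rw [real_inner_smul_left, h]
  conv_lhs => rw [← b.sum_repr' u, ← b.sum_repr' w]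
  simp only [Fin.sum_univ_three, map_add, map_smul, hSn, inner_add_left, inner_add_right,
    real_inner_smul_left, real_inner_smul_right, self, h2, hS (b 1) (b 0), smul_zero,
    inner_zero_left]
  linear_combination -inner ℝ (S (b 0)) (b 1) * (inner ℝ (b 0) u * inner ℝ (b 1) w
    - inner ℝ (b 1) u * inner ℝ (b 0) w) * hd

end CrossProduct

section Submersion

variable {M : Type*} [TopologicalSpace M] [ChartedSpace (EuclideanSpace ℝ (Fin 3)) M]
  [IsManifold (𝓡 3) ∞ M] [RiemannianBundle (fun x : M ↦ TangentSpace (𝓡 3) x)]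
  [IsContMDiffRiemannianBundle (𝓡 3) ∞ (EuclideanSpace ℝ (Fin 3))
    (fun x : M ↦ TangentSpace (𝓡 3) x)]
  {B : Type*} [TopologicalSpace B] [ChartedSpace (EuclideanSpace ℝ (Fin 2)) B]
  [IsManifold (𝓡 2) ∞ B] [RiemannianBundle (fun b : B ↦ TangentSpace (𝓡 2) b)]
  [IsContMDiffRiemannianBundle (𝓡 2) ∞ (EuclideanSpace ℝ (Fin 2))
    (fun b : B ↦ TangentSpace (𝓡 2) b)]
  {pr : M → B} {ξ : Π x : M, TangentSpace (𝓡 3) x}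

namespace IsKillingSubmersion

variable (h : IsKillingSubmersion pr ξ)
include h

/-- The covariant derivative of a field that is related to a field of the base, in horizontal
directions. -/
theorem inner_leviCivita_of_related {X Y W' : Π b : B, TangentSpace (𝓡 2) b}
    {W : Π x : M, TangentSpace (𝓡 3) x} {q : M}
    (hX : ContMDiffFieldAt (𝓡 2) ∞ X (pr q))
    (hW' : ContMDiffFieldAt (𝓡 2) ∞ W' (pr q)) (hW : ContMDiffFieldAt (𝓡 3) ∞ W q)
    (hrel : ∀ᶠ y in 𝓝 q, mfderiv (𝓡 3) (𝓡 2) pr y (W y) = W' (pr y)) :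
    inner ℝ (leviCivita (𝓡 3) W q (horizontalLift pr X q)) (horizontalLift pr Y q) =
      inner ℝ (leviCivita (𝓡 2) W' (pr q) (X (pr q))) (Y (pr q)) +
        inner ℝ (W q) (ξ q) *
          inner ℝ (leviCivita (𝓡 3) ξ q (horizontalLift pr X q)) (horizontalLift pr Y q) := by
  have le2 : (2 : ℕ∞ω) ≤ ∞ := ENat.LEInfty.out
  have hXl := contMDiffAt_horizontalLift h.submersion.smooth hX
  have hWl := contMDiffAt_horizontalLift h.submersion.smooth hW'
  have hWld := hWl.mdifferentiableAt (n := ∞) (by simp)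
  have hξd := h.killing.mdifferentiableAt q
  have hfd := mdifferentiableAt_inner (hW.mdifferentiableAt (n := ∞) (by simp)) hξd
  have hev : ∀ᶠ y in 𝓝 q, W y =
      (horizontalLift pr W' + (fun y ↦ inner ℝ (W y) (ξ y)) • ξ) y := by
    filter_upwards [hrel] with y hy
    rw [Pi.add_apply, h.horizontalLift_of_related hy]
    exact (sub_add_cancel _ _).symm
  rw [leviCivita_congr (hW.mdifferentiableAt (n := ∞) (by simp))
      (mdifferentiableAt_add_section hWld (hfd.smul_section hξd)) hev,
    leviCivita_add hWld (hfd.smul_section hξd), add_apply,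
    leviCivita_smul_apply hξd hfd, inner_add_left, inner_add_left, real_inner_smul_left,
    real_inner_smul_left, real_inner_comm (horizontalLift pr Y q) (ξ q),
    h.inner_horizontalLift_killing, mul_zero, add_zero]
  congr 1
  rw [real_inner_comm, inner_horizontalLift, h.mfderiv_leviCivita_horizontalLift (hX.of_le le2)
    (hW'.of_le le2) (hXl.of_le le2) (hWl.of_le le2), real_inner_comm]

/-- The vertical part of the covariant derivative of a horizontal lift. -/
theorem inner_leviCivita_horizontalLift_killing {Y : Π b : B, TangentSpace (𝓡 2) b} {q : M}
    (hY : ContMDiffFieldAt (𝓡 2) ∞ Y (pr q)) (z : TangentSpace (𝓡 3) q) :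
    inner ℝ (leviCivita (𝓡 3) (horizontalLift pr Y) q z) (ξ q) =
      -inner ℝ (leviCivita (𝓡 3) ξ q z) (horizontalLift pr Y q) := by
  have hYl := contMDiffAt_horizontalLift h.submersion.smooth hY
  have hd := leviCivita_metric_apply (hYl.mdifferentiableAt (n := ∞) (by simp))
    (h.killing.mdifferentiableAt q) z
  simp only [h.inner_horizontalLift_killing, mvfderiv_const, zero_apply] at hd
  rw [real_inner_comm _ (horizontalLift pr Y q)] at hd
  linarith

/-- O'Neill's formula for a Killing submersion. -/
theorem inner_curvature_of_horizontal {p : M} {u v : TangentSpace (𝓡 3) p}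
    (hu : inner ℝ u (ξ p) = 0) (hv : inner ℝ v (ξ p) = 0) :
    inner ℝ (curvature (𝓡 3) p u v v) u =
      inner ℝ (curvature (𝓡 2) (pr p) (mfderiv (𝓡 3) (𝓡 2) pr p u)
        (mfderiv (𝓡 3) (𝓡 2) pr p v) (mfderiv (𝓡 3) (𝓡 2) pr p v))
        (mfderiv (𝓡 3) (𝓡 2) pr p u) - 3 * inner ℝ (leviCivita (𝓡 3) ξ p u) v ^ 2 := by
  have le2 : (2 : ℕ∞ω) ≤ ∞ := ENat.LEInfty.out
  obtain ⟨X', hX', hX'p⟩ : ∃ X' : Π b : B, TangentSpace (𝓡 2) b,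
      ContMDiffFieldAt (𝓡 2) ∞ X' (pr p) ∧ X' (pr p) = mfderiv (𝓡 3) (𝓡 2) pr p u :=
    ⟨extend (EuclideanSpace ℝ (Fin 2)) _, contMDiffAt_extend _ _ _, extend_apply_self _ _⟩
  obtain ⟨Y', hY', hY'p⟩ : ∃ Y' : Π b : B, TangentSpace (𝓡 2) b,
      ContMDiffFieldAt (𝓡 2) ∞ Y' (pr p) ∧ Y' (pr p) = mfderiv (𝓡 3) (𝓡 2) pr p v :=
    ⟨extend (EuclideanSpace ℝ (Fin 2)) _, contMDiffAt_extend _ _ _, extend_apply_self _ _⟩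
  set X := horizontalLift pr X' with hX_def
  set Y := horizontalLift pr Y' with hY_def
  have hX : ContMDiffFieldAt (𝓡 3) ∞ X p := contMDiffAt_horizontalLift h.submersion.smooth hX'
  have hY : ContMDiffFieldAt (𝓡 3) ∞ Y p := contMDiffAt_horizontalLift h.submersion.smooth hY'
  have hXp : X p = u := by
    rw [hX_def, h.horizontalLift_of_related hX'p.symm, hu, zero_smul, sub_zero]
  have hYp : Y p = v := by
    rw [hY_def, h.horizontalLift_of_related hY'p.symm, hv, zero_smul, sub_zero]
  have hXd := hX.mdifferentiableAt (n := ∞) (by simp)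
  have hYd := hY.mdifferentiableAt (n := ∞) (by simp)
  have hξd := h.killing.mdifferentiableAt p
  have hpr : ContMDiffAt (𝓡 3) (𝓡 2) 2 pr p := h.submersion.smooth.contMDiffAt.of_le le2
  have hprc : ContinuousAt pr p := hpr.continuousAt
  have ev3 : ∀ {Z : Π x : M, TangentSpace (𝓡 3) x}, ContMDiffFieldAt (𝓡 3) ∞ Z p →
      ∀ᶠ y in 𝓝 p, ContMDiffFieldAt (𝓡 3) 2 Z y := fun hZ ↦
    (contMDiffAt_iff_contMDiffAt_nhds (by simp)).1 (hZ.of_le le2)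
  have ev2 : ∀ {Z : Π b : B, TangentSpace (𝓡 2) b}, ContMDiffFieldAt (𝓡 2) ∞ Z (pr p) →
      ∀ᶠ y in 𝓝 p, ContMDiffFieldAt (𝓡 2) 2 Z (pr y) := fun hZ ↦
    hprc.eventually ((contMDiffAt_iff_contMDiffAt_nhds (by simp)).1 (hZ.of_le le2))
  have relYY : ∀ᶠ y in 𝓝 p, mfderiv (𝓡 3) (𝓡 2) pr y (leviCivita (𝓡 3) Y y (Y y)) =
      leviCivita (𝓡 2) Y' (pr y) (Y' (pr y)) := by
    filter_upwards [ev3 hY, ev2 hY'] with y hy hy' using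
      h.mfderiv_leviCivita_horizontalLift hy' hy' hy hy
  have relXY : ∀ᶠ y in 𝓝 p, mfderiv (𝓡 3) (𝓡 2) pr y (leviCivita (𝓡 3) Y y (X y)) =
      leviCivita (𝓡 2) Y' (pr y) (X' (pr y)) := by
    filter_upwards [ev3 hY, ev2 hY', ev3 hX, ev2 hX'] with y hy hy' hx hx' using
      h.mfderiv_leviCivita_horizontalLift hx' hy' hx hy
  have t₁ := h.inner_leviCivita_of_related (Y := X') hX' (contMDiffAt_leviCivita hY' hY')
    (contMDiffAt_leviCivita hY hY) relYY
  have t₂ := h.inner_leviCivita_of_related (Y := X') hY' (contMDiffAt_leviCivita hX' hY')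
    (contMDiffAt_leviCivita hX hY) relXY
  have vert := h.inner_leviCivita_horizontalLift_killing hY'
  have vertX := h.inner_leviCivita_horizontalLift_killing hX'
  have hbr := leviCivita_sub_swap hXd hYd
  have hbrξ : inner ℝ (mlieBracket (𝓡 3) X Y p) (ξ p) =
      -2 * inner ℝ (leviCivita (𝓡 3) ξ p (X p)) (Y p) := by
    rw [← hbr, inner_sub_left, vert, vertX, h.killing.inner_leviCivita_skew p (Y p) (X p)]
    ring
  have hbrD : mfderiv (𝓡 3) (𝓡 2) pr p (mlieBracket (𝓡 3) X Y p) =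
      mlieBracket (𝓡 2) X' Y' (pr p) :=
    mfderiv_mlieBracket_of_related hpr (hX.of_le le2) (hY.of_le le2) (hX'.of_le le2)
      (hY'.of_le le2) (.of_forall (h.mfderiv_horizontalLift X'))
      (.of_forall (h.mfderiv_horizontalLift Y'))
  have hbr' : mlieBracket (𝓡 3) X Y p = horizontalLift pr (mlieBracket (𝓡 2) X' Y') p +
      inner ℝ (mlieBracket (𝓡 3) X Y p) (ξ p) • ξ p := by
    rw [h.horizontalLift_of_related hbrD, sub_add_cancel]
  -- the derivative of a horizontal lift along the fibers
  have fib : inner ℝ (leviCivita (𝓡 3) Y p (ξ p)) (X p) =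
      inner ℝ (leviCivita (𝓡 3) ξ p (Y p)) (X p) := by
    have hvb : mfderiv (𝓡 3) (𝓡 2) pr p (mlieBracket (𝓡 3) ξ Y p) = 0 := by
      have h0 : ContMDiffFieldAt (𝓡 2) 2 (0 : Π b : B, TangentSpace (𝓡 2) b) (pr p) :=
        contMDiff_zeroSection ℝ (TangentSpace (𝓡 2) : B → Type _) (pr p)
      have := mfderiv_mlieBracket_of_related hpr ((h.killing.smooth p).of_le le2)
        (hY.of_le le2) h0 (hY'.of_le le2) (.of_forall h.mfderiv_killing)
        (.of_forall (h.mfderiv_horizontalLift Y'))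
      rwa [mlieBracket_zero_left] at this
    have hin : inner ℝ (mlieBracket (𝓡 3) ξ Y p) (X p) = 0 := by
      rw [real_inner_comm, hX_def, inner_horizontalLift, hvb, inner_zero_right]
    rw [← leviCivita_sub_swap hξd hYd, inner_sub_left] at hin
    linarith
  have t₃ : inner ℝ (leviCivita (𝓡 3) Y p (mlieBracket (𝓡 3) X Y p)) (X p) =
      inner ℝ (leviCivita (𝓡 2) Y' (pr p) (mlieBracket (𝓡 2) X' Y' (pr p))) (X' (pr p)) +
        2 * inner ℝ (leviCivita (𝓡 3) ξ p (X p)) (Y p) ^ 2 := by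
    have hZ' := contMDiffAt_mlieBracket (m := ⊤) (n := ⊤) le_top hX' hY'
    have hl := h.inner_leviCivita_of_related (Y := X') hZ' hY' hY
      (.of_forall (h.mfderiv_horizontalLift Y'))
    rw [hY_def, h.inner_horizontalLift_killing, zero_mul, add_zero] at hl
    rw [hbr', map_add, map_smul, inner_add_left, real_inner_smul_left, fib, hbrξ, hl,
      h.killing.inner_leviCivita_skew p (Y p) (X p)]
    ring
  have hR := curvatureField_eq_curvature hX hY hY
  have hR' := curvatureField_eq_curvature hX' hY' hY'
  rw [vert, h.killing.inner_leviCivita_self] at t₁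
  rw [vert, h.killing.inner_leviCivita_skew p (Y p) (X p)] at t₂
  rw [← hX'p, ← hY'p, ← hXp, ← hYp, ← hR, ← hR', curvatureField, curvatureField]
  simp only [inner_sub_left]
  rw [t₁, t₂, t₃]
  ring

end IsKillingSubmersion

end Submersion

end KillingSubmersion

end

open KillingSubmersion in
theorem lemma2p8
    {M : Type*} [TopologicalSpace M] [T2Space M] [ChartedSpace (EuclideanSpace ℝ (Fin 3)) M]
    [IsManifold (𝓡 3) ∞ M] [RiemannianBundle (fun x : M ↦ TangentSpace (𝓡 3) x)]
    [IsContMDiffRiemannianBundle (𝓡 3) ∞ (EuclideanSpace ℝ (Fin 3))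
      (fun x : M ↦ TangentSpace (𝓡 3) x)]
    {B : Type*} [TopologicalSpace B] [T2Space B] [ChartedSpace (EuclideanSpace ℝ (Fin 2)) B]
    [IsManifold (𝓡 2) ∞ B] [RiemannianBundle (fun b : B ↦ TangentSpace (𝓡 2) b)]
    [IsContMDiffRiemannianBundle (𝓡 2) ∞ (EuclideanSpace ℝ (Fin 2))
      (fun b : B ↦ TangentSpace (𝓡 2) b)]
    (o : ManifoldOrientation M) (pr : M → B) (ξ : Π x : M, TangentSpace (𝓡 3) x)
    (h : IsKillingSubmersion pr ξ) :
    (∃ τ : M → ℝ, IsBundleCurvature o ξ τ) ∧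
    ∀ τ : M → ℝ, IsBundleCurvature o ξ τ → ∀ p : M,
      (∀ u v : TangentSpace (𝓡 3) p, IsHorizontal pr p u → IsHorizontal pr p v →
        LinearIndependent ℝ ![u, v] →
        sectionalCurvature (𝓡 3) p u v = gaussCurvature (pr p) - 3 * τ p ^ 2) ∧
      (∀ u : TangentSpace (𝓡 3) p, LinearIndependent ℝ ![u, ξ p] →
        sectionalCurvature (𝓡 3) p u (ξ p) = τ p ^ 2) := by
  refine ⟨?_, fun τ hτ p ↦ ⟨fun u v hu hv huv ↦ ?_, fun u hu ↦ ?_⟩⟩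
  · have hex : ∀ p, ∃ t : ℝ, ∀ u, leviCivita (𝓡 3) ξ p u = t • cross o u (ξ p) := fun p ↦
      exists_eq_smul_cross o (h.unit p) _ (h.killing.inner_leviCivita_skew p)
        (h.killing.leviCivita_killing h.unit p)
    choose τ hτ using hex
    exact ⟨τ, hτ⟩
  · have hpos := gram_pos_of_linearIndependent huv
    rw [h.isHorizontal_iff] at hu hv
    have hn : ∀ w : TangentSpace (𝓡 3) p, inner ℝ w (ξ p) = 0 →
        ‖mfderiv (𝓡 3) (𝓡 2) pr p w‖ = ‖w‖ := fun w hw ↦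
      h.submersion.norm_mfderiv p w (h.isHorizontal_iff.2 hw)
    have hli : LinearIndependent ℝ
        ![mfderiv (𝓡 3) (𝓡 2) pr p u, mfderiv (𝓡 3) (𝓡 2) pr p v] := by
      rw [← Matrix.det_gram_ne_zero_iff_linearIndependent]
      have : Matrix.gram ℝ ![mfderiv (𝓡 3) (𝓡 2) pr p u, mfderiv (𝓡 3) (𝓡 2) pr p v] =
          Matrix.gram ℝ ![u, v] := by
        ext i j
        fin_cases i <;> fin_cases j <;>
          simp [Matrix.gram_apply, hn, h.inner_mfderiv_mfderiv, hu, hv]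
      rw [this, Matrix.det_gram_ne_zero_iff_linearIndependent]
      exact huv
    rw [gaussCurvature_eq_sectionalCurvature hli, sectionalCurvature, sectionalCurvature,
      h.inner_curvature_of_horizontal hu hv, hn u hu, hn v hv, h.inner_mfderiv_mfderiv hu hv,
      hτ p u, real_inner_smul_left, mul_pow, inner_cross_sq o (h.unit p) hu hv]
    field_simp
  · have hpos := gram_pos_of_linearIndependent hu
    rw [sectionalCurvature, h.killing.inner_curvature_killing h.unit, hτ p u, norm_smul, mul_pow,
      norm_sq_cross o (h.unit p), Real.norm_eq_abs, sq_abs]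
    rw [h.unit, one_pow, mul_one] at hpos ⊢
    field_simp
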